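/- All semigroups are finite and nonempty. An ordered semigroup is a semigroup with a partial order $\le$ such that $s\le t$ implies $as\le at$ and $sa\le ta$. A pseudovariety of semigroups (respectively, of ordered semigroups) is a class of finite semigroups (respectively, finite ordered semigroups) closed under homomorphic images, subsemigroups and finite direct products, the empty product included (respectively, images under isotone homomorphisms, subsemigroups with the induced order, and finite direct products with the componentwise order). A pseudovariety of semigroups $\mathsf V$ is identified with the pseudovariety of ordered semigroups consisting of the members of $\mathsf V$ equipped with all possible stable partial orders. Let $\mathcal L(\mathsf V)$ be the lattice (under inclusion) of all pseudovarieties of semigroups contained in $\mathsf V$, and $\mathcal L_o(\mathsf V)$ the lattice of all pseudovarieties of ordered semigroups contained in $\mathsf V$. Let $\mathsf{Sl}$, $\mathsf{RB}$, $\mathsf{NB}$, $\mathsf G$ be the pseudovarieties of all finite semilattices, of all finite rectangular bands ($x^2=x$, $xyx=x$), of all finite normal bands ($x^2=x$, $xyzx=xzyx$) and of all finite groups, respectively, and let $\mathsf{NOCR}$ be the pseudovariety of all finite normal orthogroups, that is, of all finite completely regular semigroups (every element lies in a subgroup) whose idempotents form a subsemigroup that is a normal band. Theorem. For every $\mathsf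 V\in\mathcal L_o(\mathsf{NOCR})$, the pseudovarieties of ordered semigroups $\mathsf V\cap\mathsf{RB}$ and $\mathsf V\cap\mathsf G$ are (under the above identification) pseudovarieties of semigroups, and the mapping $$\iota:\mathcal L_o(\mathsf{NOCR})\to\mathcal L_o(\mathsf{Sl})\times\mathcal L(\mathsf{RB})\times\mathcal L(\mathsf G),\qquad \iota(\mathsf V)=(\mathsf V\cap\mathsf{Sl},\ \mathsf V\cap\mathsf{RB},\ \mathsf V\cap\mathsf G),$$ is a lattice isomorphism. Moreover, the lattice $\mathcal L_o(\mathsf{NOCR})$ is isomorphic to the direct product $\mathcal L_o(\mathsf{NB})\times\mathcal L(\mathsf G)$. -/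

import Mathlib

/-- A finite (nonempty) semigroup. -/
structure FinSemigroup : Type 1 where
  /-- the underlying set -/
  carrier : Type
  [semigroup : Semigroup carrier]
  [finite : Finite carrier]
  [nonempty : Nonempty carrier]

/-- A finite (nonempty) ordered semigroup: a semigroup with a stable partial order, that is, one
with `s ≤ t → a * s ≤ a * t` (`MulLeftMono`) and `s ≤ t → s * a ≤ t * a` (`MulRightMono`). -/
structure FinOrdSemigroup : Type 1 where
  /-- the underlying set -/
  carrier : Type
  [semigroup : Semigroup carrier]
  [finite : Finite carrier]
  [nonempty : Nonempty carrier]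
  [partialOrder : PartialOrder carrier]
  [mulLeftMono : MulLeftMono carrier]
  [mulRightMono : MulRightMono carrier]

namespace FinSemigroup

instance : CoeSort FinSemigroup Type := ⟨FinSemigroup.carrier⟩

attribute [instance] semigroup finite nonempty

/-- The direct product of a finite family of finite semigroups. -/
def pi {ι : Type} [Finite ι] (S : ι → FinSemigroup) : FinSemigroup where
  carrier := ∀ i, S i

end FinSemigroup

namespace FinOrdSemigroup

instance : CoeSort FinOrdSemigroup Type := ⟨FinOrdSemigroup.carrier⟩

attribute [instance] semigroup finite nonempty partialOrder mulLeftMono mulRightMono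

/-- The direct product of a finite family of finite ordered semigroups, with the componentwise
multiplication and the componentwise order. -/
def pi {ι : Type} [Finite ι] (S : ι → FinOrdSemigroup) : FinOrdSemigroup where
  carrier := ∀ i, S i
  mulLeftMono := ⟨fun a x y (h : x ≤ y) i => mul_le_mul_right (h i) (a i)⟩
  mulRightMono := ⟨fun a x y (h : x ≤ y) i => mul_le_mul_left (h i) (a i)⟩

/-- The semigroup underlying an ordered semigroup. -/
def forget (S : FinOrdSemigroup) : FinSemigroup where
  carrier := S

end FinOrdSemigroup

/-- A pseudovariety of semigroups: a class of finite semigroups closed under homomorphic images,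
subsemigroups (up to isomorphism) and finite direct products, including the empty product. -/
@[ext] structure Pseudovariety : Type 1 where
  /-- the members -/
  carrier : Set FinSemigroup
  image_mem : ∀ {S T : FinSemigroup} (f : S →ₙ* T), Function.Surjective f →
    S ∈ carrier → T ∈ carrier
  sub_mem : ∀ {S T : FinSemigroup} (f : S →ₙ* T), Function.Injective f →
    T ∈ carrier → S ∈ carrier
  pi_mem : ∀ {ι : Type} [Finite ι] (S : ι → FinSemigroup), (∀ i, S i ∈ carrier) →
    FinSemigroup.pi S ∈ carrier

/-- A pseudovariety of ordered semigroups: a class of finite ordered semigroups closed under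
images by isotone homomorphisms, ordered subsemigroups (with the induced order, up to isomorphism;
an order embedding is injective) and finite direct products, including the empty product. -/
@[ext] structure OrdPseudovariety : Type 1 where
  /-- the members -/
  carrier : Set FinOrdSemigroup
  image_mem : ∀ {S T : FinOrdSemigroup} (f : S →ₙ* T), Monotone f → Function.Surjective f →
    S ∈ carrier → T ∈ carrier
  sub_mem : ∀ {S T : FinOrdSemigroup} (f : S →ₙ* T), (∀ a b, f a ≤ f b ↔ a ≤ b) →
    T ∈ carrier → S ∈ carrier
  pi_mem : ∀ {ι : Type} [Finite ι] (S : ι → FinOrdSemigroup), (∀ i, S i ∈ carrier) →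
    FinOrdSemigroup.pi S ∈ carrier

namespace Pseudovariety

instance : Membership FinSemigroup Pseudovariety := ⟨fun V S => S ∈ V.carrier⟩

/-- Pseudovarieties are ordered by inclusion. -/
instance : PartialOrder Pseudovariety where
  le V W := ∀ S, S ∈ V → S ∈ W
  le_refl _ _ h := h
  le_trans _ _ _ h k S hS := k S (h S hS)
  le_antisymm _ _ h k := Pseudovariety.ext (Set.ext fun S => ⟨h S, k S⟩)

/-- The intersection of a set of pseudovarieties. -/
instance : InfSet Pseudovariety where
  sInf X :=
    { carrier := {S | ∀ V ∈ X, S ∈ V}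
      image_mem := fun f hf hS V hV => V.image_mem f hf (hS V hV)
      sub_mem := fun f hf hT V hV => V.sub_mem f hf (hT V hV)
      pi_mem := fun S hS V hV => V.pi_mem S fun i => hS i V hV }

/-- The intersection of two pseudovarieties. -/
instance : Min Pseudovariety where
  min V W :=
    { carrier := {S | S ∈ V ∧ S ∈ W}
      image_mem := fun f hf hS => ⟨V.image_mem f hf hS.1, W.image_mem f hf hS.2⟩
      sub_mem := fun f hf hT => ⟨V.sub_mem f hf hT.1, W.sub_mem f hf hT.2⟩
      pi_mem := fun S hS => ⟨V.pi_mem S fun i => (hS i).1, W.pi_mem S fun i => (hS i).2⟩ }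

/-- The lattice of pseudovarieties: meets are intersections, and a join is the intersection of
all pseudovarieties that contain the given ones. -/
instance : CompleteLattice Pseudovariety where
  __ := completeLatticeOfInf Pseudovariety fun _ =>
    ⟨fun _ hV _ hS => hS _ hV, fun _ hW S hS _ hV => hW hV S hS⟩
  inf := min
  inf_le_left _ _ _ h := h.1
  inf_le_right _ _ _ h := h.2
  le_inf _ _ _ h k S hS := ⟨h S hS, k S hS⟩

/-- `𝓛(V)`: the lattice of all subpseudovarieties of the pseudovariety of semigroups `V`. -/
abbrev L (V : Pseudovariety) : Type 1 := Set.Iic V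

/-- The pseudovariety of ordered semigroups that consists of the members of `V`, equipped with
every possible stable partial order. -/
def toOrd (V : Pseudovariety) : OrdPseudovariety where
  carrier := {S | S.forget ∈ V}
  image_mem {S T} f _ hf hS := V.image_mem (S := S.forget) (T := T.forget) f hf hS
  sub_mem {S T} f hf hT := V.sub_mem (S := S.forget) (T := T.forget) f
    (fun (a b : S) (h : f a = f b) =>
      le_antisymm (α := S.carrier) ((hf a b).1 (le_of_eq h)) ((hf b a).1 (le_of_eq h.symm))) hT
  pi_mem S hS := V.pi_mem (fun i => (S i).forget) hS

end Pseudovariety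

namespace OrdPseudovariety

instance : Membership FinOrdSemigroup OrdPseudovariety := ⟨fun V S => S ∈ V.carrier⟩

/-- Pseudovarieties of ordered semigroups are ordered by inclusion. -/
instance : PartialOrder OrdPseudovariety where
  le V W := ∀ S, S ∈ V → S ∈ W
  le_refl _ _ h := h
  le_trans _ _ _ h k S hS := k S (h S hS)
  le_antisymm _ _ h k := OrdPseudovariety.ext (Set.ext fun S => ⟨h S, k S⟩)

/-- The intersection of a set of pseudovarieties. -/
instance : InfSet OrdPseudovariety where
  sInf X :=
    { carrier := {S | ∀ V ∈ X, S ∈ V}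
      image_mem := fun f hm hf hS V hV => V.image_mem f hm hf (hS V hV)
      sub_mem := fun f hf hT V hV => V.sub_mem f hf (hT V hV)
      pi_mem := fun S hS V hV => V.pi_mem S fun i => hS i V hV }

/-- The intersection of two pseudovarieties. -/
instance : Min OrdPseudovariety where
  min V W :=
    { carrier := {S | S ∈ V ∧ S ∈ W}
      image_mem := fun f hm hf hS => ⟨V.image_mem f hm hf hS.1, W.image_mem f hm hf hS.2⟩
      sub_mem := fun f hf hT => ⟨V.sub_mem f hf hT.1, W.sub_mem f hf hT.2⟩
      pi_mem := fun S hS => ⟨V.pi_mem S fun i => (hS i).1, W.pi_mem S fun i => (hS i).2⟩ }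

/-- The lattice of pseudovarieties of ordered semigroups: meets are intersections, and a join is
the intersection of all pseudovarieties that contain the given ones. -/
instance : CompleteLattice OrdPseudovariety where
  __ := completeLatticeOfInf OrdPseudovariety fun _ =>
    ⟨fun _ hV _ hS => hS _ hV, fun _ hW S hS _ hV => hW hV S hS⟩
  inf := min
  inf_le_left _ _ _ h := h.1
  inf_le_right _ _ _ h := h.2
  le_inf _ _ _ h k S hS := ⟨h S hS, k S hS⟩

end OrdPseudovariety

/-- `𝓛ₒ(V)`: the lattice of all pseudovarieties of ordered semigroups contained in the
pseudovariety of semigroups `V` (equipped with every possible stable partial order). -/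
abbrev Pseudovariety.Lo (V : Pseudovariety) : Type 1 := Set.Iic V.toOrd

/-- A semigroup is a group. -/
def IsGroupSemigroup (S : Type) [Semigroup S] : Prop :=
  ∃ e : S, (∀ a, e * a = a ∧ a * e = a) ∧ ∀ a, ∃ b, a * b = e ∧ b * a = e

/-- A semigroup is completely regular (every element lies in a subgroup): every element `a` has
an inverse commuting with `a`. -/
def IsCompletelyRegular (S : Type) [Semigroup S] : Prop :=
  ∀ a : S, ∃ x, a * x * a = a ∧ a * x = x * a

/-- A normal orthogroup: a completely regular semigroup whose idempotents form a subsemigroup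
which is a normal band, that is, a band satisfying `x y z x = x z y x`. -/
def IsNormalOrthogroup (S : Type) [Semigroup S] : Prop :=
  IsCompletelyRegular S ∧
  (∀ e f : S, e * e = e → f * f = f → (e * f) * (e * f) = e * f) ∧
  ∀ e f g : S, e * e = e → f * f = f → g * g = g → e * f * g * e = e * g * f * e

theorem IsGroupSemigroup.of_injective {S T : Type} [Semigroup S] [Finite S] [Nonempty S]
    [Semigroup T] (f : S →ₙ* T) (hf : Function.Injective f) (hT : IsGroupSemigroup T) :
    IsGroupSemigroup S := by
  obtain ⟨u, hu, hinv⟩ := hT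
  have cancel : ∀ a b c : T, a * b = a * c → b = c := by
    intro a b c h
    obtain ⟨a', -, h'⟩ := hinv a
    rw [← (hu b).1, ← (hu c).1, ← h', mul_assoc, h, mul_assoc]
  have surj : ∀ a : S, Function.Surjective fun b => a * b := fun a =>
    Finite.surjective_of_injective fun b c h =>
      hf (cancel (f a) _ _ (by rw [← map_mul, ← map_mul]; exact congrArg f h))
  obtain ⟨a₀⟩ := ‹Nonempty S›
  obtain ⟨e, he⟩ := surj a₀ a₀
  have hfe : f e = u := cancel (f a₀) _ _ (by
    rw [← map_mul, (hu (f a₀)).2]; exact congrArg f he)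
  refine ⟨e, fun a => ⟨hf ?_, hf ?_⟩, fun a => ?_⟩
  · rw [map_mul, hfe, (hu _).1]
  · rw [map_mul, hfe, (hu _).2]
  · obtain ⟨b, hb⟩ := surj a e
    have hb' : f a * f b = u := by rw [← map_mul, ← hfe]; exact congrArg f hb
    refine ⟨b, hb, hf ?_⟩
    apply cancel (f a)
    rw [map_mul, ← mul_assoc, hb', hfe, (hu _).1, (hu _).2]

theorem IsCompletelyRegular.of_injective {S T : Type} [Semigroup S] [Finite S]
    [Semigroup T] (f : S →ₙ* T) (hf : Function.Injective f) (hT : IsCompletelyRegular T) :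
    IsCompletelyRegular S := by
  intro a
  obtain ⟨x, hx, hc⟩ := hT (f a)
  let A : Set S := {t | a * t = t * a ∧ f a * x * f t = f t}
  have haA : a ∈ A := ⟨rfl, hx⟩
  let m : A → A := fun t => ⟨a * t.1, by
    refine ⟨by rw [mul_assoc, ← t.2.1], ?_⟩
    rw [map_mul, ← mul_assoc, hx]⟩
  have hm : Function.Injective m := by
    intro s t h
    have h' : a * s.1 = a * t.1 := congrArg Subtype.val h
    apply Subtype.ext
    apply hf
    rw [← s.2.2, ← t.2.2, hc, mul_assoc, mul_assoc, ← map_mul, ← map_mul, h']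
  have hs := Finite.surjective_of_injective hm
  obtain ⟨t, ht⟩ := hs ⟨a, haA⟩
  obtain ⟨u, hu⟩ := hs t
  have ht' : a * t.1 = a := congrArg Subtype.val ht
  have hu' : a * u.1 = t.1 := congrArg Subtype.val hu
  refine ⟨u.1, ?_, u.2.1⟩
  rw [mul_assoc, ← u.2.1, hu', ht']

/-- In the image of a completely regular semigroup, idempotents lift to idempotents. -/
theorem IsCompletelyRegular.lift_idempotent {S T : Type} [Semigroup S] [Semigroup T]
    (f : S →ₙ* T) (hf : Function.Surjective f) (hS : IsCompletelyRegular S) (e : T)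
    (he : e * e = e) : ∃ a : S, a * a = a ∧ f a = e := by
  obtain ⟨a, rfl⟩ := hf e
  obtain ⟨x, hx, hc⟩ := hS a
  refine ⟨a * x, by rw [← mul_assoc, hx], ?_⟩
  calc f (a * x) = f a * f a * f x := by rw [he, map_mul]
    _ = f (a * x * a) := by rw [mul_assoc a x a, ← hc, ← mul_assoc, map_mul, map_mul]
    _ = f a := by rw [hx]

namespace Pseudovariety

/-- The pseudovariety `Sl` of all finite semilattices. -/
def Sl : Pseudovariety where
  carrier := {S | (∀ x : S, x * x = x) ∧ ∀ x y : S, x * y = y * x}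
  image_mem := by
    rintro S T f hf ⟨h₁, h₂⟩
    constructor
    · intro x
      obtain ⟨x, rfl⟩ := hf x
      rw [← map_mul, h₁]
    · intro x y
      obtain ⟨x, rfl⟩ := hf x
      obtain ⟨y, rfl⟩ := hf y
      rw [← map_mul, h₂, map_mul]
  sub_mem := by
    rintro S T f hf ⟨h₁, h₂⟩
    exact ⟨fun x => hf (by simp only [map_mul, h₁]),
      fun x y => hf (by rw [map_mul, h₂, map_mul])⟩
  pi_mem := fun S hS =>
    ⟨fun x => funext fun i => (hS i).1 (x i), fun x y => funext fun i => (hS i).2 (x i) (y i)⟩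

/-- The pseudovariety `RB` of all finite rectangular bands. -/
def RB : Pseudovariety where
  carrier := {S | (∀ x : S, x * x = x) ∧ ∀ x y : S, x * y * x = x}
  image_mem := by
    rintro S T f hf ⟨h₁, h₂⟩
    constructor
    · intro x
      obtain ⟨x, rfl⟩ := hf x
      rw [← map_mul, h₁]
    · intro x y
      obtain ⟨x, rfl⟩ := hf x
      obtain ⟨y, rfl⟩ := hf y
      rw [← map_mul, ← map_mul, h₂]
  sub_mem := by
    rintro S T f hf ⟨h₁, h₂⟩
    exact ⟨fun x => hf (by simp only [map_mul, h₁]),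
      fun x y => hf (by simp only [map_mul, h₂])⟩
  pi_mem := fun S hS =>
    ⟨fun x => funext fun i => (hS i).1 (x i), fun x y => funext fun i => (hS i).2 (x i) (y i)⟩

/-- The pseudovariety `NB` of all finite normal bands. -/
def NB : Pseudovariety where
  carrier := {S | (∀ x : S, x * x = x) ∧ ∀ x y z : S, x * y * z * x = x * z * y * x}
  image_mem := by
    rintro S T f hf ⟨h₁, h₂⟩
    constructor
    · intro x
      obtain ⟨x, rfl⟩ := hf x
      rw [← map_mul, h₁]
    · intro x y z
      obtain ⟨x, rfl⟩ := hf x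
      obtain ⟨y, rfl⟩ := hf y
      obtain ⟨z, rfl⟩ := hf z
      simp only [← map_mul, h₂ x y z]
  sub_mem := by
    rintro S T f hf ⟨h₁, h₂⟩
    exact ⟨fun x => hf (by simp only [map_mul, h₁]),
      fun x y z => hf (by simp only [map_mul, h₂ (f x) (f y) (f z)])⟩
  pi_mem := fun S hS =>
    ⟨fun x => funext fun i => (hS i).1 (x i),
      fun x y z => funext fun i => (hS i).2 (x i) (y i) (z i)⟩

/-- The pseudovariety `G` of all finite groups. -/
def G : Pseudovariety where
  carrier := {S | IsGroupSemigroup S}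
  image_mem := by
    rintro S T f hf ⟨e, h₁, h₂⟩
    refine ⟨f e, fun a => ?_, fun a => ?_⟩
    · obtain ⟨a, rfl⟩ := hf a
      simp only [← map_mul, h₁ a, and_self]
    · obtain ⟨a, rfl⟩ := hf a
      obtain ⟨b, hb, hb'⟩ := h₂ a
      exact ⟨f b, by rw [← map_mul, hb], by rw [← map_mul, hb']⟩
  sub_mem f hf hT := IsGroupSemigroup.of_injective f hf hT
  pi_mem := by
    intro ι _ S hS
    choose e h₁ h₂ using hS
    refine ⟨e, fun a => ⟨funext fun i => (h₁ i (a i)).1, funext fun i => (h₁ i (a i)).2⟩,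
      fun a => ?_⟩
    choose b hb hb' using fun i => h₂ i (a i)
    exact ⟨b, funext hb, funext hb'⟩

/-- The pseudovariety `NOCR` of all finite normal orthogroups. -/
def NOCR : Pseudovariety where
  carrier := {S | IsNormalOrthogroup S}
  image_mem := by
    rintro S T f hf ⟨h₁, h₂, h₃⟩
    refine ⟨fun a => ?_, fun e e' he he' => ?_, fun e e' e'' he he' he'' => ?_⟩
    · obtain ⟨a, rfl⟩ := hf a
      obtain ⟨x, hx, hc⟩ := h₁ a
      exact ⟨f x, by rw [← map_mul, ← map_mul, hx], by rw [← map_mul, hc, map_mul]⟩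
    · obtain ⟨e, ke, rfl⟩ := h₁.lift_idempotent f hf e he
      obtain ⟨e', ke', rfl⟩ := h₁.lift_idempotent f hf e' he'
      rw [← map_mul, ← map_mul, h₂ e e' ke ke']
    · obtain ⟨e, ke, rfl⟩ := h₁.lift_idempotent f hf e he
      obtain ⟨e', ke', rfl⟩ := h₁.lift_idempotent f hf e' he'
      obtain ⟨e'', ke'', rfl⟩ := h₁.lift_idempotent f hf e'' he''
      simp only [← map_mul, h₃ e e' e'' ke ke' ke'']
  sub_mem := by
    rintro S T f hf ⟨h₁, h₂, h₃⟩
    have key : ∀ e : S, e * e = e → f e * f e = f e := fun e he => by rw [← map_mul, he]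
    refine ⟨h₁.of_injective f hf, fun e e' he he' => hf ?_, fun e e' e'' he he' he'' => hf ?_⟩
    · simp only [map_mul, h₂ _ _ (key e he) (key e' he')]
    · simp only [map_mul, h₃ _ _ _ (key e he) (key e' he') (key e'' he'')]
  pi_mem := by
    intro ι _ S hS
    refine ⟨fun a => ?_, fun e e' he he' => funext fun i => ?_,
      fun e e' e'' he he' he'' => funext fun i => ?_⟩
    · choose x hx hc using fun i => (hS i).1 (a i)
      exact ⟨x, funext hx, funext hc⟩
    · exact (hS i).2.1 _ _ (congrFun he i) (congrFun he' i)
    · exact (hS i).2.2 _ _ _ (congrFun he i) (congrFun he' i) (congrFun he'' i)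

end Pseudovariety

/-! The proof shows that a pseudovariety `V` of ordered normal orthogroups is the join of its
semilattices, rectangular bands and groups, and that these three parts can be prescribed
independently.

Generation. The idempotents of a normal orthogroup `S` fall into rectangular bands, indexed by the
structure semilattice of `S`. For an idempotent `e`, consider the elements `a` whose class lies
above that of `e`, and let `f` be the identity of the maximal subgroup of `a`. On these elements
both `a ↦ f e f`, into the rectangular band of `e`, and `a ↦ e a e`, into the maximal subgroup at
`e`, are multiplicative (`unit_mul_mul`, `local_mul`). The order of `S` induces a stable order on
the structure semilattice, and `a ≤ b` follows once the classes are comparable and all local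
projections agree (`le_of_idemLE`). So `S` divides a product of an ordered semilattice, trivially
ordered rectangular bands and trivially ordered groups (`mem_of_components`). The trivial orders are
available: a finite group has no other stable order, and a rectangular band with the trivial order
embeds in a power of any ordered version of itself.

Independence. A join consists of the divisors of products (`mem_sup_iff`). A semilattice,
rectangular band or group that divides a product of one factor of each kind already divides the
factor of its own kind (`mem_left_of_mem_sup_sup` and its two companions).

Hence taking parts and taking joins are mutually inverse monotone maps, that is, a lattice
isomorphism. Keeping semilattices and rectangular bands together inside `NB`, whose groups are
trivial, gives the second isomorphism. -/

namespace FinSemigroup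

/-- A finite semigroup with the trivial order. -/
def discrete (S : FinSemigroup) : FinOrdSemigroup where
  carrier := S
  partialOrder :=
    { le := fun a b => a = b
      le_refl := fun _ => rfl
      le_trans := fun _ _ _ => Eq.trans
      le_antisymm := fun _ _ h _ => h }
  mulLeftMono := ⟨fun a _ _ h => congrArg (a * ·) h⟩
  mulRightMono := ⟨fun a _ _ h => congrArg (· * a) h⟩

end FinSemigroup

/-! ### Division and products of ordered semigroups -/

namespace FinOrdSemigroup

/-- A nonempty subsemigroup of a finite ordered semigroup, with the induced order. -/
def sub (A : FinOrdSemigroup) (s : Subsemigroup A) [Nonempty s] : FinOrdSemigroup where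
  carrier := s
  mulLeftMono := ⟨fun a _ _ h => mul_le_mul_right (α := A) h a.1⟩
  mulRightMono := ⟨fun a _ _ h => mul_le_mul_left (α := A) h a.1⟩

/-- The direct product of two finite ordered semigroups. -/
def prod (A B : FinOrdSemigroup) : FinOrdSemigroup where
  carrier := A × B
  mulLeftMono := ⟨fun a x y (h : x ≤ y) =>
    show a.1 * x.1 ≤ a.1 * y.1 ∧ a.2 * x.2 ≤ a.2 * y.2 from
      ⟨mul_le_mul_right h.1 a.1, mul_le_mul_right h.2 a.2⟩⟩
  mulRightMono := ⟨fun a x y (h : x ≤ y) =>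
    show x.1 * a.1 ≤ y.1 * a.1 ∧ x.2 * a.2 ≤ y.2 * a.2 from
      ⟨mul_le_mul_left h.1 a.1, mul_le_mul_left h.2 a.2⟩⟩

/-- `T` divides `A` if it is an isotone image of a subsemigroup of `A`; the graph of the partial
map from `A` to `T` is given as a relation. -/
def Divides (T A : FinOrdSemigroup) : Prop :=
  ∃ ρ : T → A → Prop, (∀ t, ∃ a, ρ t a) ∧
    (∀ s t a b, ρ s a → ρ t b → ρ (s * t) (a * b)) ∧
    ∀ s t a b, ρ s a → ρ t b → a ≤ b → s ≤ t

theorem Divides.refl (T : FinOrdSemigroup) : T.Divides T :=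
  ⟨fun s t => s = t, fun t => ⟨t, rfl⟩, by rintro _ _ _ _ rfl rfl; rfl,
    by rintro _ _ _ _ rfl rfl h; exact h⟩

theorem Divides.trans {T A B : FinOrdSemigroup} : T.Divides A → A.Divides B → T.Divides B := by
  rintro ⟨ρ, h₁, h₂, h₃⟩ ⟨σ, k₁, k₂, k₃⟩
  refine ⟨fun t b => ∃ a, ρ t a ∧ σ a b, fun t => ?_, ?_, ?_⟩
  · obtain ⟨a, ha⟩ := h₁ t
    obtain ⟨b, hb⟩ := k₁ a
    exact ⟨b, a, ha, hb⟩
  · rintro s t a b ⟨x, hx, hx'⟩ ⟨y, hy, hy'⟩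
    exact ⟨x * y, h₂ _ _ _ _ hx hy, k₂ _ _ _ _ hx' hy'⟩
  · rintro s t a b ⟨x, hx, hx'⟩ ⟨y, hy, hy'⟩ hab
    exact h₃ _ _ _ _ hx hy (k₃ _ _ _ _ hx' hy' hab)

theorem Divides.prod {T A T' A' : FinOrdSemigroup} :
    T.Divides A → T'.Divides A' → (T.prod T').Divides (A.prod A') := by
  rintro ⟨ρ, h₁, h₂, h₃⟩ ⟨σ, k₁, k₂, k₃⟩
  refine ⟨fun t a => ρ t.1 a.1 ∧ σ t.2 a.2, fun t => ?_, ?_, ?_⟩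
  · obtain ⟨a, ha⟩ := h₁ t.1
    obtain ⟨b, hb⟩ := k₁ t.2
    exact ⟨(a, b), ha, hb⟩
  · rintro s t a b ⟨hx, hx'⟩ ⟨hy, hy'⟩
    exact ⟨h₂ _ _ _ _ hx hy, k₂ _ _ _ _ hx' hy'⟩
  · rintro s t a b ⟨hx, hx'⟩ ⟨hy, hy'⟩ hab
    exact ⟨h₃ _ _ _ _ hx hy hab.1, k₃ _ _ _ _ hx' hy' hab.2⟩

end FinOrdSemigroup

/-! ### Joins, trivially ordered members and ordered quotients -/

namespace OrdPseudovariety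

open FinOrdSemigroup

/-- The domain of the relation is a subsemigroup of `A`. By antisymmetry the order clause makes the
relation single-valued there, hence an isotone homomorphism onto `T`. -/
theorem mem_of_divides (V : OrdPseudovariety) {T A : FinOrdSemigroup} (h : T.Divides A)
    (hA : A ∈ V) : T ∈ V := by
  obtain ⟨ρ, h₁, h₂, h₃⟩ := h
  let s : Subsemigroup A :=
    { carrier := {a | ∃ t, ρ t a}
      mul_mem' := by
        rintro a b ⟨t, ht⟩ ⟨u, hu⟩
        exact ⟨t * u, h₂ _ _ _ _ ht hu⟩ }
  obtain ⟨t₀⟩ := T.nonempty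
  obtain ⟨a₀, ha₀⟩ := h₁ t₀
  have : Nonempty s := ⟨⟨a₀, t₀, ha₀⟩⟩
  have hs : A.sub s ∈ V := V.sub_mem (S := A.sub s) (T := A)
    ⟨fun x => x.1, fun _ _ => rfl⟩ (fun _ _ => Iff.rfl) hA
  choose g hg using fun x : s => x.2
  refine V.image_mem (S := A.sub s) (T := T) ⟨g, fun x y => ?_⟩ (fun x y hxy => ?_)
    (fun t => ?_) hs
  · exact le_antisymm (h₃ _ _ _ _ (hg _) (h₂ _ _ _ _ (hg x) (hg y)) le_rfl)
      (h₃ _ _ _ _ (h₂ _ _ _ _ (hg x) (hg y)) (hg _) le_rfl)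
  · exact h₃ _ _ _ _ (hg x) (hg y) hxy
  · obtain ⟨a, ha⟩ := h₁ t
    exact ⟨⟨a, t, ha⟩, le_antisymm (h₃ _ _ _ _ (hg _) ha le_rfl) (h₃ _ _ _ _ ha (hg _) le_rfl)⟩

theorem prod_mem (V : OrdPseudovariety) {A B : FinOrdSemigroup} (hA : A ∈ V) (hB : B ∈ V) :
    A.prod B ∈ V := by
  let F : Bool → FinOrdSemigroup := fun i => cond i A B
  have hF : FinOrdSemigroup.pi F ∈ V := V.pi_mem F (by rintro (_ | _) <;> assumption)
  refine V.mem_of_divides ⟨fun t (f : ∀ i, F i) => t.1 = f true ∧ t.2 = f false, fun t => ?_, ?_, ?_⟩ hF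
  · exact ⟨fun i => match i with
      | true => t.1
      | false => t.2, rfl, rfl⟩
  · rintro s t a b ⟨h, h'⟩ ⟨k, k'⟩
    exact ⟨congrArg₂ (· * ·) h k, congrArg₂ (· * ·) h' k'⟩
  · rintro s t a b ⟨h, h'⟩ ⟨k, k'⟩ hab
    exact ⟨(h.le.trans (hab true)).trans k.ge, (h'.le.trans (hab false)).trans k'.ge⟩

theorem one_mem (V : OrdPseudovariety) {T : FinOrdSemigroup} (hT : Subsingleton T) : T ∈ V := by
  let F : Empty → FinOrdSemigroup := Empty.elim
  have hF : FinOrdSemigroup.pi F ∈ V := V.pi_mem F (by rintro ⟨⟩)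
  exact V.mem_of_divides ⟨fun _ _ => True, fun _ => ⟨fun i => i.elim, trivial⟩,
    fun _ _ _ _ _ _ => trivial, fun s t _ _ _ _ _ => (Subsingleton.elim s t).le⟩ hF

/-- The class of all divisors of `A.prod B` with `A` in `V` and `B` in `W`. -/
def divisors (V W : OrdPseudovariety) : OrdPseudovariety where
  carrier := {T | ∃ A ∈ V, ∃ B ∈ W, T.Divides (A.prod B)}
  image_mem := by
    rintro S T f hf hs ⟨A, hA, B, hB, h⟩
    refine ⟨A, hA, B, hB, Divides.trans ⟨fun t s => t = f s, fun t => ?_, ?_, ?_⟩ h⟩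
    · obtain ⟨s, rfl⟩ := hs t
      exact ⟨s, rfl⟩
    · rintro _ _ a b rfl rfl
      exact (map_mul f a b).symm
    · rintro _ _ a b rfl rfl hab
      exact hf hab
  sub_mem := by
    rintro S T f hf ⟨A, hA, B, hB, h⟩
    refine ⟨A, hA, B, hB, Divides.trans ⟨fun s t => t = f s, fun s => ⟨_, rfl⟩, ?_, ?_⟩ h⟩
    · rintro a b _ _ rfl rfl
      exact (map_mul f a b).symm
    · rintro a b _ _ rfl rfl hab
      exact (hf a b).1 hab
  pi_mem := by
    intro ι _ S hS
    choose A hA B hB ρ h₁ h₂ h₃ using hS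
    refine ⟨FinOrdSemigroup.pi A, V.pi_mem A hA, FinOrdSemigroup.pi B, W.pi_mem B hB,
      fun s x => ∀ i, ρ i (s i) (x.1 i, x.2 i), fun s => ?_, ?_, ?_⟩
    · choose x hx using fun i => h₁ i (s i)
      exact ⟨(fun i => (x i).1, fun i => (x i).2), hx⟩
    · exact fun s t a b hs ht i => h₂ i _ _ _ _ (hs i) (ht i)
    · exact fun s t a b hs ht hab i => h₃ i _ _ _ _ (hs i) (ht i) ⟨hab.1 i, hab.2 i⟩

/-- The divisors of such products form a pseudovariety, and it contains `V` and `W` because the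
empty product can serve as the other factor. -/
theorem mem_sup_iff {V W : OrdPseudovariety} {T : FinOrdSemigroup} :
    T ∈ V ⊔ W ↔ ∃ A ∈ V, ∃ B ∈ W, T.Divides (A.prod B) := by
  constructor
  · have hV : V ≤ divisors V W := fun S hS => by
      let I : FinOrdSemigroup := (FinOrdSemigroup.pi (Empty.elim : Empty → FinOrdSemigroup))
      have hI : I ∈ W := W.pi_mem _ (by rintro ⟨⟩)
      exact ⟨S, hS, I, hI, fun s x => s = x.1, fun s => ⟨(s, fun i => i.elim), rfl⟩,
        by rintro _ _ a b rfl rfl; rfl, by rintro _ _ a b rfl rfl h; exact h.1⟩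
    have hW : W ≤ divisors V W := fun S hS => by
      let I : FinOrdSemigroup := (FinOrdSemigroup.pi (Empty.elim : Empty → FinOrdSemigroup))
      have hI : I ∈ V := V.pi_mem _ (by rintro ⟨⟩)
      exact ⟨I, hI, S, hS, fun s x => s = x.2, fun s => ⟨(fun i => i.elim, s), rfl⟩,
        by rintro _ _ a b rfl rfl; rfl, by rintro _ _ a b rfl rfl h; exact h.2⟩
    exact fun h => sup_le hV hW T h
  · rintro ⟨A, hA, B, hB, h⟩
    exact mem_of_divides _ h (prod_mem _ ((le_sup_left : V ≤ V ⊔ W) A hA)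
      ((le_sup_right : W ≤ V ⊔ W) B hB))

theorem mem_sup_sup_iff {U V W : OrdPseudovariety} {T : FinOrdSemigroup} :
    T ∈ U ⊔ (V ⊔ W) ↔
      ∃ A ∈ U, ∃ B ∈ V, ∃ C ∈ W, T.Divides (A.prod (B.prod C)) := by
  constructor
  · intro h
    obtain ⟨A, hA, D, hD, h⟩ := mem_sup_iff.1 h
    obtain ⟨B, hB, C, hC, h'⟩ := mem_sup_iff.1 hD
    exact ⟨A, hA, B, hB, C, hC, h.trans ((Divides.refl A).prod h')⟩
  · rintro ⟨A, hA, B, hB, C, hC, h⟩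
    exact mem_sup_iff.2 ⟨A, hA, _, mem_sup_iff.2 ⟨B, hB, C, hC, Divides.refl _⟩, h⟩

theorem exists_of_mem_sup_sup {U V W : OrdPseudovariety} {T : FinOrdSemigroup}
    (h : T ∈ U ⊔ (V ⊔ W)) : ∃ A ∈ U, ∃ B ∈ V, ∃ C ∈ W, ∃ ρ : T → A → B → C → Prop,
      (∀ t, ∃ a b c, ρ t a b c) ∧
      (∀ {s t a b c a' b' c'}, ρ s a b c → ρ t a' b' c' → ρ (s * t) (a * a') (b * b') (c * c')) ∧
      ∀ {s t a b c a' b' c'}, ρ s a b c → ρ t a' b' c' → a ≤ a' → b ≤ b' → c ≤ c' → s ≤ t := by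
  obtain ⟨A, hA, B, hB, C, hC, ρ, h₁, h₂, h₃⟩ := mem_sup_sup_iff.1 h
  refine ⟨A, hA, B, hB, C, hC, fun t a b c => ρ t (a, b, c), fun t => ?_, ?_, ?_⟩
  · obtain ⟨⟨a, b, c⟩, hx⟩ := h₁ t
    exact ⟨a, b, c, hx⟩
  · exact fun h k => h₂ _ _ _ _ h k
  · exact fun h k ha hb hc => h₃ _ _ _ _ h k ⟨ha, hb, hc⟩

/-- The pseudovariety of all finite semigroups whose trivially ordered version belongs to `V`. -/
def disc (V : OrdPseudovariety) : Pseudovariety where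
  carrier := {S | S.discrete ∈ V}
  image_mem {S T} f hf hS := V.image_mem (S := S.discrete) (T := T.discrete) f
    (fun _ _ h => congrArg f h) hf hS
  sub_mem {S T} f hf hT := V.sub_mem (S := S.discrete) (T := T.discrete) f
    (fun _ _ => hf.eq_iff) hT
  pi_mem S hS := V.sub_mem (S := (FinSemigroup.pi S).discrete)
    (T := FinOrdSemigroup.pi fun i => (S i).discrete) ⟨fun x => x, fun _ _ => rfl⟩
    (fun _ _ => ⟨fun h => funext h, fun h i => congrFun h i⟩)
    (V.pi_mem (fun i => (S i).discrete) hS)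

theorem mem_of_forget_mem_disc (V : OrdPseudovariety) {S : FinOrdSemigroup}
    (h : S.forget ∈ V.disc) : S ∈ V :=
  V.image_mem (S := S.forget.discrete) (T := S) ⟨fun x => x, fun _ _ => rfl⟩
    (fun _ _ h => le_of_eq h) (fun x => ⟨x, rfl⟩) h

theorem disc_toOrd (V : Pseudovariety) : V.toOrd.disc = V := rfl

theorem disc_mono {V W : OrdPseudovariety} (h : V ≤ W) : V.disc ≤ W.disc :=
  fun S hS => h S.discrete hS

/-- If trivial orders are available in `V` on all members of `W`, then the intersection of `V`
and `W` is a pseudovariety of semigroups. -/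
theorem toOrd_disc_inf {V : OrdPseudovariety} {W : Pseudovariety}
    (h : ∀ S : FinOrdSemigroup, S ∈ V → S.forget ∈ W → S.forget.discrete ∈ V) :
    (V.disc ⊓ W).toOrd = V ⊓ W.toOrd :=
  le_antisymm (fun _ hS => ⟨V.mem_of_forget_mem_disc hS.1, hS.2⟩)
    fun S hS => ⟨h S hS.1 hS.2, hS.2⟩

/-- A stable preorder that contains the order of `T` gives an isotone quotient of `T`. -/
theorem exists_quotient (V : OrdPseudovariety) {T : FinOrdSemigroup} (hT : T ∈ V)
    (r : T → T → Prop) (hr : ∀ {a b}, a ≤ b → r a b) (htrans : ∀ {a b c}, r a b → r b c → r a c)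
    (hleft : ∀ {a b} c, r a b → r (c * a) (c * b))
    (hright : ∀ {a b} c, r a b → r (a * c) (b * c)) :
    ∃ Y ∈ V, ∃ π : T →ₙ* Y, Function.Surjective π ∧ ∀ a b, π a ≤ π b ↔ r a b := by
  -- The symmetric part of `r` is a congruence, and `r` descends to a stable partial order on its
  -- classes.
  let c : Con T :=
    { r := fun a b => r a b ∧ r b a
      iseqv := ⟨fun _ => ⟨hr le_rfl, hr le_rfl⟩, fun h => ⟨h.2, h.1⟩,
        fun h k => ⟨htrans h.1 k.1, htrans k.2 h.2⟩⟩
      mul' := fun h k => ⟨htrans (hright _ h.1) (hleft _ k.1), htrans (hright _ h.2) (hleft _ k.2)⟩ }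
  let le : c.Quotient → c.Quotient → Prop := fun x y => Quotient.liftOn₂ x y r
    fun a b a' b' (h : r a a' ∧ r a' a) (k : r b b' ∧ r b' b) => propext
      ⟨fun l => htrans h.2 (htrans l k.1), fun l => htrans h.1 (htrans l k.2)⟩
  let po : PartialOrder c.Quotient :=
    { le := le
      le_refl := by
        rintro ⟨a⟩
        exact hr (a := a) le_rfl
      le_trans := by
        rintro ⟨a⟩ ⟨b⟩ ⟨d⟩ h k
        exact htrans (a := a) (b := b) (c := d) h k
      le_antisymm := by
        rintro ⟨a⟩ ⟨b⟩ h k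
        exact Quotient.sound (s := c.toSetoid) ⟨h, k⟩ }
  let Y : FinOrdSemigroup :=
    { carrier := c.Quotient
      finite := Quotient.finite c.toSetoid
      nonempty := T.nonempty.map fun a : T => (a : c.Quotient)
      mulLeftMono := ⟨by
        rintro ⟨d⟩ ⟨a⟩ ⟨b⟩ h
        exact hleft (a := a) (b := b) d h⟩
      mulRightMono := ⟨by
        rintro ⟨d⟩ ⟨a⟩ ⟨b⟩ h
        exact hright (a := a) (b := b) d h⟩ }
  let π : T →ₙ* Y := ⟨fun a : T => (a : c.Quotient), fun _ _ => rfl⟩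
  have hπ : Function.Surjective π := Quotient.mk_surjective
  exact ⟨Y, V.image_mem (S := T) (T := Y) π (fun a b h => hr (a := a) (b := b) h) hπ hT, π, hπ,
    fun _ _ => Iff.rfl⟩

end OrdPseudovariety

theorem Pseudovariety.toOrd_mono {V W : Pseudovariety} (h : V ≤ W) : V.toOrd ≤ W.toOrd :=
  fun S hS => h S.forget hS

theorem Pseudovariety.toOrd_injective {V W : Pseudovariety} (h : V.toOrd = W.toOrd) : V = W :=
  (OrdPseudovariety.disc_toOrd V).symm.trans
    ((congrArg OrdPseudovariety.disc h).trans (OrdPseudovariety.disc_toOrd W))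

/-! ### Trivial orders on rectangular bands and groups -/

theorem rectangularBand_mul_mul {S : Type*} [Semigroup S] (h : ∀ x y : S, x * y * x = x)
    (x y z : S) : x * y * z = x * z := by
  calc x * y * z = x * y * (z * x * z) := by rw [h z x]
    _ = x * (y * z) * x * z := by simp only [mul_assoc]
    _ = x * z := by rw [h]

/-- Any two elements of a rectangular band are interchanged by an endomorphism. -/
theorem rectangularBand_exists_swap {S : Type*} [Semigroup S] (h₁ : ∀ x : S, x * x = x)
    (h₂ : ∀ x y : S, x * y * x = x) (s t : S) : ∃ σ : S →ₙ* S, σ s = t ∧ σ t = s := by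
  classical
  have h₃ := rectangularBand_mul_mul h₂
  -- In left-zero by right-zero coordinates, `x * s = s` says that `x` and `s` share the left
  -- coordinate, and `s * x = s` the right one. Arbitrary maps of the two coordinates give an
  -- endomorphism. Here the coordinates of `s` go to those of `t`, and all others to those of `s`.
  refine ⟨⟨fun x => (if x * s = s then t else s) * (if s * x = s then t else s), fun x y => ?_⟩,
    ?_, ?_⟩
  · rw [h₃ x y s, ← mul_assoc s x y, h₃ s x y, ← mul_assoc, h₃ _ _ (if y * s = s then t else s),
      h₃]
  · simp [h₁]
  · change (if t * s = s then t else s) * (if s * t = s then t else s) = s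
    by_cases h : t * s = s <;> by_cases k : s * t = s
    · rw [if_pos h, if_pos k, h₁, ← h₂ t s, h, k]
    · rw [if_pos h, if_neg k, h]
    · rw [if_neg h, if_pos k, k]
    · rw [if_neg h, if_neg k, h₁]

/-- Evaluation embeds `S` in its power indexed by the endomorphisms of `S`. Since some endomorphism
interchanges `s` and `t`, distinct elements become incomparable there. -/
theorem OrdPseudovariety.discrete_mem_of_rectangularBand (V : OrdPseudovariety)
    (S : FinOrdSemigroup) (hS : S ∈ V) (h : S.forget ∈ Pseudovariety.RB) :
    S.forget.discrete ∈ V := by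
  have : Finite (S →ₙ* S) := DFunLike.finite _
  refine V.sub_mem (S := S.forget.discrete) (T := FinOrdSemigroup.pi fun _ : S →ₙ* S => S)
    ⟨fun x σ => σ x, fun x y => funext fun σ => map_mul σ x y⟩ (fun s t => ⟨fun k => ?_, ?_⟩)
    (V.pi_mem _ fun _ => hS)
  · obtain ⟨σ, hs, ht⟩ := rectangularBand_exists_swap (S := S) h.1 h.2 s t
    have h₁ : S.partialOrder.le s t := k (MulHom.id S)
    have h₂ : S.partialOrder.le (σ s) (σ t) := k σ
    rw [hs, ht] at h₂
    exact S.partialOrder.le_antisymm _ _ h₁ h₂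
  · rintro rfl
    exact le_rfl

/-- A stable order on a finite group is trivial. -/
theorem IsGroupSemigroup.eq_of_le {S : Type} [Semigroup S] [Finite S] [PartialOrder S]
    [MulRightMono S] (h : IsGroupSemigroup S) {a b : S} (hab : a ≤ b) : a = b := by
  obtain ⟨e, he, hinv⟩ := h
  by_contra hne
  obtain ⟨a', ha, ha'⟩ := hinv a
  -- As `b * a'` lies above the identity, left translation by it is increasing. It maps the set of
  -- points that it moves into itself, so a maximal point of that set would be fixed.
  have hext : ∀ x, x ≤ b * a' * x := fun x => by
    have := mul_le_mul_left (mul_le_mul_left hab a') x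
    rwa [ha, (he x).1] at this
  have hinj : ∀ x y, b * a' * x = b * a' * y → x = y := fun x y hxy => by
    obtain ⟨c, -, hc⟩ := hinv (b * a')
    rw [← (he x).1, ← hc, mul_assoc, hxy, ← mul_assoc, hc, (he y).1]
  have ha₀ : a ∈ {x | b * a' * x ≠ x} := by
    change b * a' * a ≠ a
    rw [mul_assoc, ha', (he b).2]
    exact Ne.symm hne
  obtain ⟨m, hm⟩ := (Set.toFinite {x | b * a' * x ≠ x}).exists_maximal ⟨a, ha₀⟩
  have hm' : b * a' * m ∈ {x | b * a' * x ≠ x} := fun k => hm.1 (hinj _ _ k)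
  exact hm.1 (le_antisymm (hm.2 hm' (hext m)) (hext m))

theorem OrdPseudovariety.discrete_mem_of_group (V : OrdPseudovariety)
    (S : FinOrdSemigroup) (hS : S ∈ V) (h : S.forget ∈ Pseudovariety.G) :
    S.forget.discrete ∈ V :=
  V.sub_mem (S := S.forget.discrete) (T := S) ⟨fun x => x, fun _ _ => rfl⟩
    (fun _ _ => ⟨fun k => IsGroupSemigroup.eq_of_le (S := S) h k, fun k => le_of_eq k⟩) hS

/-! ### Independence of the three components in a join -/

theorem exists_idempotent_of_finite {M : Type*} [Semigroup M] [Finite M] (s : Set M)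
    (hs : s.Nonempty) (hmul : ∀ x ∈ s, ∀ y ∈ s, x * y ∈ s) : ∃ m ∈ s, m * m = m := by
  -- In the discrete topology this is the Ellis–Numakura lemma.
  let : TopologicalSpace M := ⊥
  have : DiscreteTopology M := ⟨rfl⟩
  exact exists_idempotent_in_compact_subsemigroup (fun _ => continuous_of_discreteTopology) s hs
    s.toFinite.isCompact hmul

theorem eq_of_idempotent_of_identity {M : Type*} [Semigroup M] {e a : M}
    (he : ∀ x : M, e * x = x ∧ x * e = x) (hinv : ∃ b, a * b = e ∧ b * a = e) (ha : a * a = a) :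
    a = e := by
  obtain ⟨b, h, h'⟩ := hinv
  rw [← (he a).1, ← h', mul_assoc, ha, h']

namespace OrdPseudovariety

variable {X : OrdPseudovariety} {Y Z : Pseudovariety}

/-- The triples related to an idempotent `t` form a subsemigroup, and an idempotent triple has group
coordinate `u`; so triples over `u` still reach all of `T`. If `a ≤ a'`, sandwiching restores the
band coordinate (`b b' b = b`) and gives `s ≤ s t s` and `t s t ≤ t`; the middle terms agree in a
semilattice. -/
theorem mem_left_of_mem_sup_sup (hX : X ≤ Pseudovariety.Sl.toOrd) (hY : Y ≤ Pseudovariety.RB)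
    (hZ : Z ≤ Pseudovariety.G) {T : FinOrdSemigroup} (hT : T ∈ X ⊔ (Y.toOrd ⊔ Z.toOrd))
    (h : T.forget ∈ Pseudovariety.Sl) : T ∈ X := by
  obtain ⟨A, hA, B, hB, C, hC, ρ, h₁, h₂, h₃⟩ := exists_of_mem_sup_sup hT
  obtain ⟨a₁, a₂⟩ : (∀ x : A, x * x = x) ∧ ∀ x y : A, x * y = y * x := hX A hA
  obtain ⟨b₁, b₂⟩ : (∀ x : B, x * x = x) ∧ ∀ x y : B, x * y * x = x := hY B.forget hB
  obtain ⟨u, hu, hinv⟩ : IsGroupSemigroup C := hZ C.forget hC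
  obtain ⟨t₁, t₂⟩ : (∀ x : T, x * x = x) ∧ ∀ x y : T, x * y = y * x := h
  refine X.mem_of_divides ⟨fun t a => ∃ b, ρ t a b u, fun t => ?_, ?_, ?_⟩ hA
  · obtain ⟨a₀, b₀, c₀, h₀⟩ := h₁ t
    obtain ⟨⟨a, b, c⟩, hx, hi⟩ := exists_idempotent_of_finite (M := A × B × C)
      {x | ρ t x.1 x.2.1 x.2.2} ⟨(a₀, b₀, c₀), h₀⟩ (fun x hx y hy => by
        have := h₂ hx hy
        rwa [t₁] at this)
    obtain rfl : c = u :=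
      eq_of_idempotent_of_identity hu (hinv c) (congrArg (fun x : A × B × C => x.2.2) hi)
    exact ⟨a, b, hx⟩
  · rintro s t a a' ⟨b, hb⟩ ⟨b', hb'⟩
    refine ⟨b * b', ?_⟩
    have := h₂ hb hb'
    rwa [(hu u).1] at this
  · rintro s t a a' ⟨b, hb⟩ ⟨b', hb'⟩ haa
    have k₁ := h₂ (h₂ hb hb') hb
    have k₂ := h₂ (h₂ hb' hb) hb'
    rw [(hu u).1, (hu u).1, b₂] at k₁ k₂
    have e₁ : s ≤ s * t * s := h₃ hb k₁ (by
      have := mul_le_mul_left (mul_le_mul_right haa a) a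
      rwa [a₁, a₁] at this) le_rfl le_rfl
    have e₂ : t * s * t ≤ t := h₃ k₂ hb' (by
      have := mul_le_mul_left (mul_le_mul_right haa a') a'
      rwa [a₁, a₁] at this) le_rfl le_rfl
    refine e₁.trans (le_trans (le_of_eq ?_) e₂)
    rw [t₂ s t, mul_assoc, t₁, mul_assoc, t₂ s t, ← mul_assoc, t₁]

/-- The group coordinate is again reduced to `u`. Replacing `s` by `s t s = s` and `t` by `t s t =
t` keeps the band coordinates and makes the semilattice coordinates equal. -/
theorem mem_middle_of_mem_sup_sup (hX : X ≤ Pseudovariety.Sl.toOrd) (hY : Y ≤ Pseudovariety.RB)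
    (hZ : Z ≤ Pseudovariety.G) {T : FinOrdSemigroup} (hT : T ∈ X ⊔ (Y.toOrd ⊔ Z.toOrd))
    (h : T.forget ∈ Pseudovariety.RB) : T ∈ Y.toOrd := by
  obtain ⟨A, hA, B, hB, C, hC, ρ, h₁, h₂, h₃⟩ := exists_of_mem_sup_sup hT
  obtain ⟨a₁, a₂⟩ : (∀ x : A, x * x = x) ∧ ∀ x y : A, x * y = y * x := hX A hA
  obtain ⟨b₁, b₂⟩ : (∀ x : B, x * x = x) ∧ ∀ x y : B, x * y * x = x := hY B.forget hB
  obtain ⟨u, hu, hinv⟩ : IsGroupSemigroup C := hZ C.forget hC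
  obtain ⟨t₁, t₂⟩ : (∀ x : T, x * x = x) ∧ ∀ x y : T, x * y * x = x := h
  refine Y.toOrd.mem_of_divides ⟨fun t b => ∃ a, ρ t a b u, fun t => ?_, ?_, ?_⟩ hB
  · obtain ⟨a₀, b₀, c₀, h₀⟩ := h₁ t
    obtain ⟨⟨a, b, c⟩, hx, hi⟩ := exists_idempotent_of_finite (M := A × B × C)
      {x | ρ t x.1 x.2.1 x.2.2} ⟨(a₀, b₀, c₀), h₀⟩ (fun x hx y hy => by
        have := h₂ hx hy
        rwa [t₁] at this)
    obtain rfl : c = u :=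
      eq_of_idempotent_of_identity hu (hinv c) (congrArg (fun x : A × B × C => x.2.2) hi)
    exact ⟨b, a, hx⟩
  · rintro s t b b' ⟨a, hb⟩ ⟨a', hb'⟩
    refine ⟨a * a', ?_⟩
    have := h₂ hb hb'
    rwa [(hu u).1] at this
  · rintro s t b b' ⟨a, hb⟩ ⟨a', hb'⟩ hbb
    have k₁ := h₂ (h₂ hb hb') hb
    have k₂ := h₂ (h₂ hb' hb) hb'
    rw [t₂, b₂] at k₁ k₂
    refine h₃ k₁ k₂ (le_of_eq ?_) hbb le_rfl
    rw [a₂ a a', mul_assoc, a₁, mul_assoc, a₂ a a', ← mul_assoc, a₁]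

/-- Over the idempotent pair `(a a', b b')` the identity of `T` is related to the identity of `C`.
Sandwiching by this triple changes neither `s`, `t` nor the group coordinates, but makes the other
coordinates of `s` and `t` equal. -/
theorem mem_right_of_mem_sup_sup (hX : X ≤ Pseudovariety.Sl.toOrd) (hY : Y ≤ Pseudovariety.RB)
    (hZ : Z ≤ Pseudovariety.G) {T : FinOrdSemigroup} (hT : T ∈ X ⊔ (Y.toOrd ⊔ Z.toOrd))
    (h : T.forget ∈ Pseudovariety.G) : T ∈ Z.toOrd := by
  obtain ⟨A, hA, B, hB, C, hC, ρ, h₁, h₂, h₃⟩ := exists_of_mem_sup_sup hT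
  obtain ⟨a₁, a₂⟩ : (∀ x : A, x * x = x) ∧ ∀ x y : A, x * y = y * x := hX A hA
  obtain ⟨b₁, b₂⟩ : (∀ x : B, x * x = x) ∧ ∀ x y : B, x * y * x = x := hY B.forget hB
  obtain ⟨u, hu, hinv⟩ : IsGroupSemigroup C := hZ C.forget hC
  obtain ⟨v, hv, tinv⟩ : IsGroupSemigroup T := h
  refine Z.toOrd.mem_of_divides ⟨fun t c => ∃ a b, ρ t a b c, fun t => ?_, ?_, ?_⟩ hC
  · obtain ⟨a, b, c, hx⟩ := h₁ t
    exact ⟨c, a, b, hx⟩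
  · rintro s t c c' ⟨a, b, hb⟩ ⟨a', b', hb'⟩
    exact ⟨a * a', b * b', h₂ hb hb'⟩
  · rintro s t c c' ⟨a, b, hb⟩ ⟨a', b', hb'⟩ hcc
    obtain ⟨⟨w, z⟩, hw, hi⟩ := exists_idempotent_of_finite (M := T × C)
      {p | ρ p.1 (a * a') (b * b') p.2} ⟨(s * t, c * c'), h₂ hb hb'⟩ (fun p hp q hq => by
        have := h₂ hp hq
        rwa [a₁, b₁] at this)
    obtain rfl : w = v :=
      eq_of_idempotent_of_identity hv (tinv w) (congrArg (fun x : T × C => x.1) hi)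
    obtain rfl : z = u :=
      eq_of_idempotent_of_identity hu (hinv z) (congrArg (fun x : T × C => x.2) hi)
    have k₁ := h₂ (h₂ hw hb) hw
    have k₂ := h₂ (h₂ hw hb') hw
    rw [(hv _).1, (hv _).2, (hu _).1, (hu _).2, b₂] at k₁ k₂
    refine h₃ k₁ k₂ (le_of_eq ?_) le_rfl hcc
    rw [a₂ (a * a') a, mul_assoc, mul_assoc a a' a', a₁, a₁, a₁, ← mul_assoc, a₁]

end OrdPseudovariety

/-! ### Normal bands and the local structure of normal orthogroups -/

/-- A normal band satisfies the identity `x y z w = x z y w`. -/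
theorem normalBand_swap {B : Type*} [Semigroup B] (h₁ : ∀ x : B, x * x = x)
    (h₂ : ∀ x y z : B, x * y * z * x = x * z * y * x) (x y z w : B) :
    x * y * z * w = x * z * y * w := by
  -- The local monoid `x B x` is a semilattice onto which `y ↦ x y x` is multiplicative, so
  -- neighbouring factors commute between two equal ends.
  have ins : ∀ x y z : B, x * y * z * x = x * y * x * (x * z * x) := fun x y z => by
    calc x * y * z * x = x * z * y * x := h₂ x y z
      _ = x * (x * z) * y * x := by rw [← mul_assoc x x z, h₁]
      _ = x * y * (x * z) * x := h₂ x (x * z) y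
      _ = x * y * (x * x * z) * x := by rw [h₁]
      _ = x * y * x * (x * z * x) := by simp only [mul_assoc]
  have comm : ∀ x y z w : B, x * y * z * w * x = x * z * y * w * x := fun x y z w => by
    calc x * y * z * w * x = x * (y * z) * w * x := by simp only [mul_assoc]
      _ = x * (y * z) * x * (x * w * x) := ins _ _ _
      _ = x * (z * y) * x * (x * w * x) := by
          rw [← mul_assoc x y z, ← mul_assoc x z y, h₂]
      _ = x * (z * y) * w * x := (ins _ _ _).symm
      _ = x * z * y * w * x := by simp only [mul_assoc]
  have comm' : ∀ x y z w : B, x * y * z * w * x = x * y * w * z * x := fun x y z w => by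
    calc x * y * z * w * x = x * y * (z * w) * x := by simp only [mul_assoc]
      _ = x * y * x * (x * w * z * x) := by rw [ins, ← mul_assoc x z w, h₂]
      _ = x * y * x * (x * (w * z) * x) := by simp only [mul_assoc]
      _ = x * y * w * z * x := by rw [← ins]; simp only [mul_assoc]
  -- Squaring the word encloses the first `y z` between two `x` and the second between two `w`.
  calc x * y * z * w = x * y * z * w * (x * y * z * w) := (h₁ _).symm
    _ = x * y * z * w * x * (y * z * w) := by simp only [mul_assoc]
    _ = x * z * y * w * x * (y * z * w) := by rw [comm]
    _ = x * z * y * (w * x * y * z * w) := by simp only [mul_assoc]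
    _ = x * z * y * (w * x * z * y * w) := by rw [comm']
    _ = x * z * y * w * (x * z * y * w) := by simp only [mul_assoc]
    _ = x * z * y * w := h₁ _

namespace IsNormalOrthogroup

variable {S : Type} [Semigroup S]

theorem exists_unit (h : IsNormalOrthogroup S) (a : S) :
    ∃ e x, e * e = e ∧ e * a = a ∧ a * e = a ∧ a * x = e ∧ x * a = e ∧ x * e = x := by
  obtain ⟨x, hx, hc⟩ := h.1 a
  have he : a * x * (a * x) = a * x := by rw [← mul_assoc, hx]
  exact ⟨a * x, x * (a * x), he, hx, by rw [hc, ← mul_assoc, hx], by rw [← mul_assoc, he],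
    by rw [mul_assoc, hx, hc], by rw [mul_assoc, he]⟩

/-- The idempotent of the maximal subgroup that contains `a`. -/
noncomputable def unit (h : IsNormalOrthogroup S) (a : S) : S := (h.exists_unit a).choose

/-- An inverse of `a` modulo the idempotent `h.unit a`. -/
noncomputable def inv (h : IsNormalOrthogroup S) (a : S) : S :=
  (h.exists_unit a).choose_spec.choose

variable (h : IsNormalOrthogroup S)

theorem unit_idem (a : S) : h.unit a * h.unit a = h.unit a :=
  (h.exists_unit a).choose_spec.choose_spec.1

theorem unit_mul (a : S) : h.unit a * a = a :=
  (h.exists_unit a).choose_spec.choose_spec.2.1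

theorem mul_unit (a : S) : a * h.unit a = a :=
  (h.exists_unit a).choose_spec.choose_spec.2.2.1

theorem mul_inv (a : S) : a * h.inv a = h.unit a :=
  (h.exists_unit a).choose_spec.choose_spec.2.2.2.1

theorem inv_mul (a : S) : h.inv a * a = h.unit a :=
  (h.exists_unit a).choose_spec.choose_spec.2.2.2.2.1

theorem inv_mul_unit (a : S) : h.inv a * h.unit a = h.inv a :=
  (h.exists_unit a).choose_spec.choose_spec.2.2.2.2.2

/-- Uniqueness of the unit, which frees later arguments from the choice behind `h.unit`. -/
theorem eq_unit {a e y : S} (h₁ : e * a = a) (h₂ : y * a = e) : e = h.unit a := by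
  calc e = y * a := h₂.symm
    _ = y * a * h.unit a := by rw [mul_assoc, h.mul_unit]
    _ = e * (a * h.inv a) := by rw [h₂, h.mul_inv]
    _ = h.unit a := by rw [← mul_assoc, h₁, h.mul_inv]

theorem unit_of_idem {e : S} (he : e * e = e) : h.unit e = e := (h.eq_unit he he).symm

theorem mul_unit_of_mul {a e : S} (k : e * a = a) : e * h.unit a = h.unit a := by
  rw [← h.mul_inv, ← mul_assoc, k]

theorem unit_mul_of_mul {a e : S} (k : a * e = a) : h.unit a * e = h.unit a := by
  rw [← h.inv_mul, mul_assoc, k]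

/-- Idempotents that are not at the ends of a product can be interchanged. -/
theorem swap (h : IsNormalOrthogroup S) {e f : S} (he : e * e = e) (hf : f * f = f) (s t : S) :
    s * e * f * t = s * f * e * t := by
  let E : Subsemigroup S :=
    { carrier := {x | x * x = x}
      mul_mem' := fun {x y} hx hy => h.2.1 x y hx hy }
  have key := normalBand_swap (B := E) (fun x => Subtype.ext x.2)
    (fun x y z => Subtype.ext (h.2.2 x y z x.2 y.2 z.2)) ⟨_, h.unit_idem s⟩ ⟨e, he⟩ ⟨f, hf⟩
    ⟨_, h.unit_idem t⟩
  have key' : h.unit s * e * f * h.unit t = h.unit s * f * e * h.unit t :=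
    congrArg Subtype.val key
  calc s * e * f * t = s * (h.unit s * e * f * h.unit t) * t := by
        simp only [mul_assoc, h.unit_mul]
        rw [← mul_assoc s (h.unit s), h.mul_unit]
    _ = s * f * e * t := by
        rw [key']
        simp only [mul_assoc, h.unit_mul]
        rw [← mul_assoc s (h.unit s), h.mul_unit]

theorem swap' (h : IsNormalOrthogroup S) {e f : S} (he : e * e = e) (hf : f * f = f) (s t : S) :
    s * (e * (f * t)) = s * (f * (e * t)) := by
  simpa only [mul_assoc] using h.swap he hf s t

theorem idem_mul (h : IsNormalOrthogroup S) {e f : S} (he : e * e = e) (hf : f * f = f) : e * f * (e * f) = e * f :=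
  h.2.1 e f he hf

/-- Idempotents below the identity of a maximal subgroup commute with its elements. -/
theorem commute {a k : S} (hk : k * k = k) (h₁ : h.unit a * k = k) (h₂ : k * h.unit a = k) :
    a * k = k * a := by
  set f := h.unit a with hf
  set x := h.inv a
  -- The aim is `k = u = a k x`: these are idempotents below `f`, which commute with one another by
  -- `swap`. Then `k` equals its own conjugate by `a`.
  set u := h.unit (a * k) with hu
  have ff : f * f = f := h.unit_idem a
  have uu : u * u = u := h.unit_idem _
  have fu : f * u = u := h.mul_unit_of_mul (by rw [← mul_assoc, h.unit_mul])
  have uk : u * k = u := h.unit_mul_of_mul (by rw [mul_assoc, hk])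
  have uf : u * f = u := by rw [← uk, mul_assoc, h₂]
  have xa : x * a = f := h.inv_mul a
  have comm : ∀ g : S, g * g = g → f * g = g → g * f = g → g * u = u * g := fun g gg fg gf => by
    have := h.swap gg uu f f
    rwa [fg, fu, mul_assoc, mul_assoc, uf, gf] at this
  have ku : k = u := by
    have : x * (a * k) = k := by rw [← mul_assoc, xa, h₁]
    rw [← uk, ← comm k hk h₁ h₂]
    nth_rw 1 2 [← this]
    rw [mul_assoc, h.mul_unit]
  have g₁ : a * k * x * (a * k) = a * k := by
    rw [mul_assoc, ← mul_assoc x, xa, h₁, mul_assoc, hk]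
  have gg : a * k * x * (a * k * x) = a * k * x := by rw [← mul_assoc, g₁]
  have gu : a * k * x = u := by
    calc a * k * x = u * (a * k * x) := by rw [← mul_assoc u, h.unit_mul]
      _ = a * k * x * u := (comm _ gg (by rw [← mul_assoc, ← mul_assoc, h.unit_mul])
          (by rw [mul_assoc, h.inv_mul_unit])).symm
      _ = u := h.mul_unit_of_mul g₁
  calc a * k = a * k * x * a := by rw [mul_assoc _ x, xa, mul_assoc, h₂]
    _ = k * a := by rw [gu, ku]

theorem idem_mul_mul (h : IsNormalOrthogroup S) {e f : S} (he : e * e = e) (hf : f * f = f) :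
    e * f * e * (e * f * e) = e * f * e := by
  calc e * f * e * (e * f * e) = e * f * (e * f) * e := by
        simp only [mul_assoc]
        rw [← mul_assoc e e, he]
    _ = e * f * e := by rw [h.idem_mul he hf]

/-- With `f` the unit of `a`, the idempotent `f e f` lies below `f` and so commutes with `a`. -/
theorem mul_eq_of_idem {e : S} (he : e * e = e) (a : S) :
    e * a = e * a * e * h.unit a := by
  set f := h.unit a with hf
  have ff : f * f = f := h.unit_idem a
  have fa : f * a = a := h.unit_mul a
  have := h.commute (a := a) (k := f * e * f) (h.idem_mul_mul ff he)
    (by rw [← mul_assoc, ← mul_assoc, ff]) (by rw [mul_assoc, ff])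
  calc e * a = e * f * (e * f) * a := by rw [h.idem_mul he ff, mul_assoc, fa]
    _ = e * (f * e * f * a) := by simp only [mul_assoc]
    _ = e * (a * f * e * f) := by rw [← this]; simp only [mul_assoc]
    _ = e * a * e * f := by rw [h.mul_unit]; simp only [mul_assoc]

theorem mul_eq_of_idem' {e : S} (he : e * e = e) (a : S) :
    a * e = h.unit a * e * a * e := by
  set f := h.unit a with hf
  have ff : f * f = f := h.unit_idem a
  have := h.commute (a := a) (k := f * e * f) (h.idem_mul_mul ff he)
    (by rw [← mul_assoc, ← mul_assoc, ff]) (by rw [mul_assoc, ff])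
  calc a * e = a * (f * e * (f * e)) := by
        rw [h.idem_mul ff he, ← mul_assoc, h.mul_unit]
    _ = a * (f * e * f) * e := by simp only [mul_assoc]
    _ = f * e * (f * a) * e := by rw [this]; simp only [mul_assoc]
    _ = f * e * a * e := by rw [h.unit_mul]

/-- For idempotents, `e * f * e = e` means that the class of `e` lies below that of `f` in the
structure semilattice; this is the passage to meets. -/
theorem idem_mul_between (h : IsNormalOrthogroup S) {e f g : S} (he : e * e = e)
    (hf : f * f = f) (h₁ : e * f * e = e) (h₂ : e * g * e = e) : e * f * g * e = e := by
  have := h.swap he hf e (g * e)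
  rw [he] at this
  rw [mul_assoc, this, h₁, ← mul_assoc, h₂]

/-- The local projection to the maximal subgroup with identity `e` is multiplicative on the
elements whose `𝒥`-class is above that of `e`. -/
theorem local_mul {e : S} (he : e * e = e) {a b : S} (ha : e * h.unit a * e = e)
    (hb : e * h.unit b * e = e) : e * (a * b) * e = e * a * e * (e * b * e) := by
  have key : e * (h.unit a * (h.unit b * e)) = e := by
    simpa only [mul_assoc] using h.idem_mul_between he (h.unit_idem a) ha hb
  calc e * (a * b) * e = e * a * (b * e) := by simp only [mul_assoc]
    _ = e * a * e * h.unit a * (h.unit b * e * b * e) := by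
        rw [← h.mul_eq_of_idem he, ← h.mul_eq_of_idem' he]
    _ = e * a * (e * (h.unit a * (h.unit b * e))) * b * e := by simp only [mul_assoc]
    _ = e * a * e * b * e := by rw [key]
    _ = e * a * e * (e * b * e) := by
        simp only [mul_assoc]
        rw [← mul_assoc e e, he]

theorem unit_mul_inv (a : S) : h.unit a * h.inv a = h.inv a := by
  rw [← h.inv_mul, mul_assoc, h.mul_inv, h.inv_mul_unit]

theorem unit_inv (a : S) : h.unit (h.inv a) = h.unit a :=
  (h.eq_unit (h.unit_mul_inv a) (h.mul_inv a)).symm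

theorem local_mul_inv {e : S} (he : e * e = e) {a : S} (ha : e * h.unit a * e = e) :
    e * a * e * (e * h.inv a * e) = e := by
  rw [← h.local_mul he ha (by rwa [h.unit_inv]), h.mul_inv, ha]

theorem local_inv_mul {e : S} (he : e * e = e) {a : S} (ha : e * h.unit a * e = e) :
    e * h.inv a * e * (e * a * e) = e := by
  rw [← h.local_mul he (by rwa [h.unit_inv]) ha, h.inv_mul, ha]

theorem unit_mul_unit_mul (a b : S) : h.unit a * h.unit (a * b) = h.unit (a * b) :=
  h.mul_unit_of_mul (by rw [← mul_assoc, h.unit_mul])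

theorem unit_mul_mul_unit (a b : S) : h.unit (a * b) * h.unit b = h.unit (a * b) :=
  h.unit_mul_of_mul (by rw [mul_assoc, h.mul_unit])

/-- The class of a product is the meet of the classes. From right to left, `e a e` and `e b e` are
invertible in the maximal subgroup at `e`, hence so is their product `e (a b) e`; this forces the
class of `e` below that of `a b`. -/
theorem le_unit_mul_iff {e : S} (he : e * e = e) {a b : S} :
    e * h.unit (a * b) * e = e ↔ e * h.unit a * e = e ∧ e * h.unit b * e = e := by
  constructor
  · intro k
    have h₁ : h.unit a * h.unit (a * b) = h.unit (a * b) :=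
      h.mul_unit_of_mul (by rw [← mul_assoc, h.unit_mul])
    have h₂ : h.unit (a * b) * h.unit b = h.unit (a * b) :=
      h.unit_mul_of_mul (by rw [mul_assoc, h.mul_unit])
    constructor
    · have := h.swap' he (h.unit_idem a) e (h.unit (a * b) * e)
      rw [← mul_assoc (h.unit a) (h.unit (a * b)), h₁, ← mul_assoc e (h.unit (a * b)),
        k, he] at this
      rw [mul_assoc]
      exact this.symm
    · have := h.swap (h.unit_idem b) he (e * h.unit (a * b)) e
      rw [mul_assoc e (h.unit (a * b)) (h.unit b), h₂, k, he] at this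
      exact this.symm
  · rintro ⟨ha, hb⟩
    have hw : e * (a * b) * e * ((e * h.inv b * e) * (e * h.inv a * e)) = e := by
      rw [h.local_mul he ha hb, mul_assoc, ← mul_assoc (e * b * e), h.local_mul_inv he hb,
        ← mul_assoc e, ← mul_assoc e, he, h.local_mul_inv he ha]
    generalize (e * h.inv b * e) * (e * h.inv a * e) = w at hw
    have hz : e * h.unit (a * b) * (a * b * e * w) = e := by
      rw [mul_assoc, ← mul_assoc (h.unit (a * b)), ← mul_assoc (h.unit (a * b)), h.unit_mul,
        ← mul_assoc, ← mul_assoc, hw]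
    calc e * h.unit (a * b) * e = e * h.unit (a * b) * (e * h.unit (a * b) * (a * b * e * w)) := by
          rw [hz]
      _ = e := by rw [← mul_assoc, h.idem_mul he (h.unit_idem _), hz]

theorem unit_mul_eq (a b : S) :
    h.unit (a * b) * (h.unit a * h.unit b) * h.unit (a * b) = h.unit (a * b) := by
  rw [← mul_assoc]
  obtain ⟨h₁, h₂⟩ := (h.le_unit_mul_iff (h.unit_idem (a * b)) (a := a) (b := b)).1
    (by rw [h.unit_idem, h.unit_idem])
  exact h.idem_mul_between (h.unit_idem _) (h.unit_idem _) h₁ h₂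

theorem eq_unit_mul (a b : S) :
    h.unit a * h.unit b * h.unit (a * b) * (h.unit a * h.unit b) = h.unit a * h.unit b := by
  have key := h.idem_mul (h.unit_idem a) (h.unit_idem b)
  refine (h.le_unit_mul_iff key).2 ⟨?_, ?_⟩
  · rw [mul_assoc, ← mul_assoc (h.unit a), h.unit_idem, key]
  · rw [mul_assoc (h.unit a), h.unit_idem, key]

/-- The local projection to the rectangular band of `e` is multiplicative on the elements whose
`𝒥`-class is above that of `e`. -/
theorem unit_mul_mul {e : S} (he : e * e = e) {a b : S} (ha : e * h.unit a * e = e)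
    (hb : e * h.unit b * e = e) :
    h.unit (a * b) * e * h.unit (a * b) =
      h.unit a * e * h.unit a * (h.unit b * e * h.unit b) := by
  have hab := (h.le_unit_mul_iff he).2 ⟨ha, hb⟩
  have h₁ := h.unit_mul_unit_mul a b
  have h₂ := h.unit_mul_mul_unit a b
  have uu := h.unit_idem (a * b)
  have k₁ := h.idem_mul_between he (h.unit_idem a) ha hb
  set u := h.unit (a * b)
  set f := h.unit a
  set g := h.unit b
  calc u * e * u = f * u * e * (u * g) := by rw [h₁, h₂]
    _ = f * e * (u * u) * g := by rw [h.swap uu he]; simp only [mul_assoc]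
    _ = f * e * u * g := by rw [uu]
    _ = f * (e * e) * u * g := by rw [he]
    _ = f * e * e * u * g := by simp only [mul_assoc]
    _ = f * e * u * e * g := by rw [h.swap he uu]
    _ = f * (e * u * e) * g := by simp only [mul_assoc]
    _ = f * (e * f * g * e) * g := by rw [hab, k₁]
    _ = f * e * f * (g * e * g) := by simp only [mul_assoc]

theorem unit_mul_of_unit_eq {a x y : S} (hx : h.unit x = h.unit a) (hy : h.unit y = h.unit a) :
    h.unit (x * y) = h.unit a := by
  refine (h.eq_unit (y := h.inv y * h.inv x) ?_ ?_).symm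
  · rw [← hx, ← mul_assoc, h.unit_mul]
  · rw [mul_assoc, ← mul_assoc (h.inv x), h.inv_mul, hx, ← hy, h.unit_mul, h.inv_mul]

theorem idem_mul_equiv (h : IsNormalOrthogroup S) {e x y : S} (he : e * e = e) (hx : x * x = x)
    (hy : y * y = y) (hye : y * e * y = y) :
    x * y * e * (x * y) = x * y := by
  calc x * y * e * (x * y) = x * y * e * x * y := by simp only [mul_assoc]
    _ = x * y * x * e * y := h.swap he hx _ _
    _ = x * y * x * (e * y) := by simp only [mul_assoc]
    _ = x * x * y * (e * y) := by rw [h.swap hy hx]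
    _ = x * (y * e * y) := by rw [hx]; simp only [mul_assoc]
    _ = x * y := by rw [hye]

theorem idem_mul_mul_eq (h : IsNormalOrthogroup S) {e x y : S} (he : e * e = e)
    (hy : y * y = y) (hxe : x * e * x = x) (hye : y * e * y = y) (hey : e * y * e = e) :
    x * y * x = x := by
  calc x * y * x = x * (y * e * y) * x := by rw [hye]
    _ = x * y * e * y * x := by simp only [mul_assoc]
    _ = x * y * (y * e) * x := by rw [h.swap he hy]; simp only [mul_assoc]
    _ = x * (y * y) * (e * e) * x := by rw [he]; simp only [mul_assoc]
    _ = x * y * e * (e * x) := by rw [hy]; simp only [mul_assoc]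
    _ = x * (e * y * e) * x := by rw [h.swap hy he]; simp only [mul_assoc]
    _ = x := by rw [hey, hxe]

theorem idem_middle (h : IsNormalOrthogroup S) {y z : S} (hy : y * y = y) (hz : z * z = z)
    (s t : S) : s * y * z * y * t = s * z * y * z * t := by
  calc s * y * z * y * t = s * y * z * (y * t) := by simp only [mul_assoc]
    _ = s * z * y * (y * t) := h.swap hy hz _ _
    _ = s * (z * z) * y * t := by rw [← mul_assoc, mul_assoc (s * z), hy, hz]
    _ = s * z * z * y * t := by simp only [mul_assoc]
    _ = s * z * y * z * t := h.swap hz hy _ _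

theorem idem_collapse_right (h : IsNormalOrthogroup S) {f g k : S} (hf : f * f = f)
    (hg : g * g = g) (hk : k * k = k) : f * k * (g * k) * (f * k) = f * g * f * k := by
  calc f * k * (g * k) * (f * k) = f * k * g * (k * f * k) := by simp only [mul_assoc]
    _ = f * g * k * (k * f * k) := by rw [h.swap hk hg]
    _ = f * g * (k * k) * f * k := by simp only [mul_assoc]
    _ = f * g * k * f * k := by rw [hk]
    _ = f * g * f * (k * k) := by rw [h.swap hk hf]; simp only [mul_assoc]
    _ = f * g * f * k := by rw [hk]

theorem idem_collapse_left (h : IsNormalOrthogroup S) {f g k : S} (hf : f * f = f)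
    (hg : g * g = g) (hk : k * k = k) : k * f * (k * g) * (k * f) = k * f * g * f := by
  calc k * f * (k * g) * (k * f) = k * f * k * (g * (k * f)) := by simp only [mul_assoc]
    _ = k * k * f * (g * (k * f)) := by rw [h.swap hf hk]
    _ = k * f * g * k * f := by rw [hk]; simp only [mul_assoc]
    _ = k * f * k * g * f := by rw [h.swap hg hk]
    _ = k * f * k * (g * f) := by simp only [mul_assoc]
    _ = k * k * f * (g * f) := by rw [h.swap hf hk]
    _ = k * f * g * f := by rw [hk]; simp only [mul_assoc]

theorem idem_unit_mul_unit (a b : S) :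
    h.unit a * h.unit b * (h.unit a * h.unit b) = h.unit a * h.unit b :=
  h.idem_mul (h.unit_idem a) (h.unit_idem b)

theorem unit_mul_self (a : S) : h.unit (a * a) = h.unit a := h.unit_mul_of_unit_eq rfl rfl

end IsNormalOrthogroup

/-! ### The order of a normal orthogroup -/

namespace IsNormalOrthogroup

set_option linter.unusedSectionVars false

section Order

variable {S : Type} [Semigroup S] [PartialOrder S] [MulLeftMono S] [MulRightMono S]

/-- The preorder on the idempotents of a normal orthogroup that induces the order of the
structure semilattice. -/
def IdemLE (e f : S) : Prop := e ≤ e * f * e ∧ f * e * f ≤ f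

theorem mul_mul_le_mul_mul {a b : S} (hab : a ≤ b) (c d : S) : c * a * d ≤ c * b * d :=
  mul_le_mul_left (mul_le_mul_right hab c) d

theorem IdemLE.of_le {e f : S} (he : e * e = e) (hf : f * f = f) (hef : e ≤ f) : IdemLE e f := by
  have h₁ := mul_mul_le_mul_mul hef e e
  have h₂ := mul_mul_le_mul_mul hef f f
  rw [he, he] at h₁
  rw [hf, hf] at h₂
  exact ⟨h₁, h₂⟩

theorem IdemLE.of_equiv {e f : S} (h₁ : e * f * e = e) (h₂ : f * e * f = f) : IdemLE e f :=
  ⟨h₁.ge, h₂.le⟩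

/-- Inside a longer product `g k g` may be replaced by `k g k`, which links the inequalities of the
two hypotheses. -/
theorem IdemLE.trans (h : IsNormalOrthogroup S) {f g k : S} (hf : f * f = f) (hg : g * g = g)
    (hk : k * k = k) (h₁ : IdemLE f g) (h₂ : IdemLE g k) : IdemLE f k := by
  have mid : ∀ x y z : S, y * y = y → z * z = z →
      x * (y * z * y) * x = x * (z * y * z) * x := fun x y z hy hz => by
    simpa only [mul_assoc] using h.idem_middle hy hz x x
  constructor
  · calc f ≤ f * g * f := h₁.1
      _ ≤ f * (g * k * g) * f := mul_mul_le_mul_mul h₂.1 f f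
      _ = f * (k * g * k) * f := mid _ _ _ hg hk
      _ ≤ f * k * f := mul_mul_le_mul_mul h₂.2 f f
  · calc k * f * k ≤ k * (f * g * f) * k := mul_mul_le_mul_mul h₁.1 k k
      _ = k * (g * f * g) * k := mid _ _ _ hf hg
      _ ≤ k * g * k := mul_mul_le_mul_mul h₁.2 k k
      _ ≤ k := h₂.2

theorem IdemLE.mul_right (h : IsNormalOrthogroup S) {f g k : S} (hf : f * f = f)
    (hg : g * g = g) (hk : k * k = k) (h₁ : IdemLE f g) : IdemLE (f * k) (g * k) := by
  constructor
  · rw [h.idem_collapse_right hf hg hk]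
    exact mul_le_mul_left h₁.1 k
  · rw [h.idem_collapse_right hg hf hk]
    exact mul_le_mul_left h₁.2 k

theorem IdemLE.mul_left (h : IsNormalOrthogroup S) {f g k : S} (hf : f * f = f)
    (hg : g * g = g) (hk : k * k = k) (h₁ : IdemLE f g) : IdemLE (k * f) (k * g) := by
  constructor
  · rw [h.idem_collapse_left hf hg hk, mul_assoc, mul_assoc, ← mul_assoc f]
    exact mul_le_mul_right h₁.1 k
  · rw [h.idem_collapse_left hg hf hk, mul_assoc, mul_assoc, ← mul_assoc g]
    exact mul_le_mul_right h₁.2 k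

variable (h : IsNormalOrthogroup S)

theorem idemLE_unit_mul (a b : S) : IdemLE (h.unit (a * b)) (h.unit a * h.unit b) :=
  .of_equiv (h.unit_mul_eq a b) (h.eq_unit_mul a b)

theorem idemLE_mul_unit (a b : S) : IdemLE (h.unit a * h.unit b) (h.unit (a * b)) :=
  .of_equiv (h.eq_unit_mul a b) (h.unit_mul_eq a b)

theorem idemLE_unit_mul_left {a b : S} (c : S) (hab : IdemLE (h.unit a) (h.unit b)) :
    IdemLE (h.unit (c * a)) (h.unit (c * b)) :=
  ((h.idemLE_unit_mul c a).trans h (h.unit_idem _) (h.idem_unit_mul_unit c a)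
    (h.idem_unit_mul_unit c b) (hab.mul_left h (h.unit_idem a) (h.unit_idem b)
      (h.unit_idem c))).trans h (h.unit_idem _) (h.idem_unit_mul_unit c b) (h.unit_idem _)
        (h.idemLE_mul_unit c b)

theorem idemLE_unit_mul_right {a b : S} (c : S) (hab : IdemLE (h.unit a) (h.unit b)) :
    IdemLE (h.unit (a * c)) (h.unit (b * c)) :=
  ((h.idemLE_unit_mul a c).trans h (h.unit_idem _) (h.idem_unit_mul_unit a c)
    (h.idem_unit_mul_unit b c) (hab.mul_right h (h.unit_idem a) (h.unit_idem b)
      (h.unit_idem c))).trans h (h.unit_idem _) (h.idem_unit_mul_unit b c) (h.unit_idem _)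
        (h.idemLE_mul_unit b c)

theorem idemLE_unit_mul_comm (a b : S) : IdemLE (h.unit (a * b)) (h.unit (b * a)) := by
  have key : ∀ a b : S, h.unit a * h.unit b * (h.unit b * h.unit a) * (h.unit a * h.unit b) =
      h.unit a * h.unit b := fun a b => by
    calc h.unit a * h.unit b * (h.unit b * h.unit a) * (h.unit a * h.unit b)
        = h.unit a * (h.unit b * h.unit b) * (h.unit a * h.unit a) * h.unit b := by
          simp only [mul_assoc]
      _ = h.unit a * h.unit b * (h.unit a * h.unit b) := by
          rw [h.unit_idem, h.unit_idem, mul_assoc (h.unit a * h.unit b)]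
      _ = h.unit a * h.unit b := h.idem_unit_mul_unit a b
  exact ((h.idemLE_unit_mul a b).trans h (h.unit_idem _) (h.idem_unit_mul_unit a b)
    (h.idem_unit_mul_unit b a) (.of_equiv (key a b) (key b a))).trans h (h.unit_idem _)
      (h.idem_unit_mul_unit b a) (h.unit_idem _) (h.idemLE_mul_unit b a)

/-- Pairs `x ≤ y` from the maximal subgroups of `a` and `b` form a finite subsemigroup of `S × S`;
its idempotent is the pair of units. -/
theorem unit_mono [Finite S] {a b : S} (hab : a ≤ b) : h.unit a ≤ h.unit b := by
  obtain ⟨⟨p, q⟩, ⟨hpq, hp, hq⟩, hi⟩ := exists_idempotent_of_finite (M := S × S)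
    {x | x.1 ≤ x.2 ∧ h.unit x.1 = h.unit a ∧ h.unit x.2 = h.unit b} ⟨(a, b), hab, rfl, rfl⟩
    (fun x hx y hy => ⟨(mul_le_mul_right hy.1 x.1).trans (mul_le_mul_left hx.1 y.2),
      h.unit_mul_of_unit_eq hx.2.1 hy.2.1, h.unit_mul_of_unit_eq hx.2.2 hy.2.2⟩)
  have hp' := h.unit_of_idem (congrArg Prod.fst hi)
  have hq' := h.unit_of_idem (congrArg Prod.snd hi)
  rw [← hp, ← hq, hp', hq']
  exact hpq

/-- An inequality in a normal orthogroup can be read off from the structure semilattice and the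
local projections. -/
theorem le_of_idemLE {a b : S} (hab : IdemLE (h.unit a) (h.unit b))
    (hband : ∀ e : S, e * e = e → e * h.unit a * e = e → e * h.unit b * e = e →
      h.unit a * e * h.unit a = h.unit b * e * h.unit b)
    (hgroup : ∀ e : S, e * e = e → e * h.unit a * e = e → e * h.unit b * e = e →
      e * a * e = e * b * e) : a ≤ b := by
  have ff := h.unit_idem a
  have gg := h.unit_idem b
  have hfa := h.unit_mul a
  have haf := h.mul_unit a
  have hgb := h.unit_mul b
  have hbg := h.mul_unit b
  have ee := h.idem_mul ff gg
  set f := h.unit a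
  set g := h.unit b
  have e₁ : f * g * f * (f * g) = f * g := by
    rw [mul_assoc, ← mul_assoc f f, ff, ee]
  have e₂ : f * g * g * (f * g) = f * g := by
    rw [mul_assoc f g g, gg, ee]
  -- Only the idempotent `f g`, in the meet of the two classes, is needed. There `kb` becomes `f g f
  -- = g f g`, whence `f ≤ f g ≤ g`, and `kg` links `a = f a f` to `g b g = b`.
  have kb := hband _ ee e₁ e₂
  have kg := hgroup _ ee e₁ e₂
  have k₁ : f * (f * g) * f = f * g * f := by rw [← mul_assoc, ff]
  have k₂ : g * (f * g) * g = g * f * g := by rw [← mul_assoc, mul_assoc, gg]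
  rw [k₁, k₂] at kb
  have kf : f * g * f = f * g := by
    calc f * g * f = f * (g * f * g) := by rw [← kb, ← mul_assoc, ← mul_assoc, ff]
      _ = f * g := by rw [mul_assoc g, ← mul_assoc, ee]
  have fe : f ≤ f * g := by
    have := hab.1
    rwa [kf] at this
  have eg : f * g ≤ g := by
    have := hab.2
    rwa [← kb, kf] at this
  calc a = f * a * f := by rw [hfa, haf]
    _ ≤ f * g * a * (f * g) :=
      (mul_le_mul_left (mul_le_mul_left fe a) f).trans (mul_le_mul_right fe _)
    _ = f * g * b * (f * g) := kg
    _ ≤ g * b * g := (mul_le_mul_left (mul_le_mul_left eg b) _).trans (mul_le_mul_right eg _)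
    _ = b := by rw [hgb, hbg]

end Order
end IsNormalOrthogroup

/-! ### Decomposition into semilattice, rectangular bands and groups -/

namespace IsNormalOrthogroup

variable {S : Type} [Semigroup S]

/-- The rectangular band of all idempotents in the `𝒥`-class of the idempotent `e`. -/
def bandClass (h : IsNormalOrthogroup S) (e : S) (he : e * e = e) : Subsemigroup S where
  carrier := {x | x * x = x ∧ e * x * e = e ∧ x * e * x = x}
  mul_mem' {x y} hx hy :=
    ⟨h.idem_mul hx.1 hy.1,
      by rw [← mul_assoc]; exact h.idem_mul_between he hx.1 hx.2.1 hy.2.1,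
      h.idem_mul_equiv he hx.1 hy.1 hy.2.2⟩

/-- The maximal subgroup with identity `e`. -/
def groupClass (e : S) : Subsemigroup S where
  carrier := {x | e * x = x ∧ x * e = x ∧ ∃ y, e * y = y ∧ y * e = y ∧ x * y = e ∧ y * x = e}
  mul_mem' := by
    rintro x y ⟨hx, hx', x', h₁, h₂, h₃, h₄⟩ ⟨hy, hy', y', k₁, k₂, k₃, k₄⟩
    refine ⟨by rw [← mul_assoc, hx], by rw [mul_assoc, hy'], y' * x', ?_, ?_, ?_, ?_⟩
    · rw [← mul_assoc, k₁]
    · rw [mul_assoc, h₂]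
    · rw [mul_assoc, ← mul_assoc y, k₃, h₁, h₃]
    · rw [mul_assoc, ← mul_assoc x', h₄, hy, k₄]

theorem isGroupSemigroup_groupClass {e : S} (he : e * e = e) :
    IsGroupSemigroup (groupClass e) := by
  refine ⟨⟨e, he, he, e, he, he, he, he⟩, fun a => ⟨Subtype.ext a.2.1, Subtype.ext a.2.2.1⟩,
    fun a => ?_⟩
  obtain ⟨ha, ha', y, h₁, h₂, h₃, h₄⟩ := a.2
  exact ⟨⟨y, h₁, h₂, a, ha, ha', h₄, h₃⟩, Subtype.ext h₃, Subtype.ext h₄⟩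

variable (h : IsNormalOrthogroup S)

theorem local_mem_bandClass {e a : S} (he : e * e = e) (ha : e * h.unit a * e = e) :
    h.unit a * e * h.unit a ∈ h.bandClass e he := by
  refine ⟨h.idem_mul_mul (h.unit_idem a) he, ?_, ?_⟩
  · rw [← mul_assoc, ← mul_assoc, ha, ha]
  · calc h.unit a * e * h.unit a * e * (h.unit a * e * h.unit a)
        = h.unit a * (e * h.unit a * e) * h.unit a * e * h.unit a := by simp only [mul_assoc]
      _ = h.unit a * (e * h.unit a * e) * h.unit a := by
          nth_rw 1 [ha]
          simp only [mul_assoc]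
      _ = h.unit a * e * h.unit a := by rw [ha]

theorem local_mem_groupClass {e a : S} (he : e * e = e) (ha : e * h.unit a * e = e) :
    e * a * e ∈ groupClass e := by
  have key : ∀ x : S, e * (e * x * e) = e * x * e ∧ e * x * e * e = e * x * e := fun x =>
    ⟨by rw [← mul_assoc, ← mul_assoc, he], by rw [mul_assoc, he]⟩
  exact ⟨(key a).1, (key a).2, e * h.inv a * e, (key _).1, (key _).2, h.local_mul_inv he ha,
    h.local_inv_mul he ha⟩

end IsNormalOrthogroup

namespace OrdPseudovariety

/-- A normal orthogroup divides the product of its ordered structure semilattice, of trivially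
ordered rectangular bands and of trivially ordered groups, all of which lie in the pseudovariety
that it generates. -/
theorem mem_of_components {V J : OrdPseudovariety} {S : FinOrdSemigroup} (hS : S ∈ V)
    (h : IsNormalOrthogroup S)
    (hSl : ∀ T ∈ V, T.forget ∈ Pseudovariety.Sl → T ∈ J)
    (hRB : ∀ T ∈ V, T.forget ∈ Pseudovariety.RB → T.forget.discrete ∈ J)
    (hG : ∀ T ∈ V, T.forget ∈ Pseudovariety.G → T.forget.discrete ∈ J) : S ∈ J := by
  classical
  -- `Y` is the structure semilattice, ordered by `IdemLE`.
  obtain ⟨Y, hY, π, hπ, hle⟩ := V.exists_quotient hS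
    (fun a b => IsNormalOrthogroup.IdemLE (h.unit a) (h.unit b))
    (fun hab => .of_le (h.unit_idem _) (h.unit_idem _) (h.unit_mono hab))
    (fun h₁ h₂ => h₁.trans h (h.unit_idem _) (h.unit_idem _) (h.unit_idem _) h₂)
    (fun c hab => h.idemLE_unit_mul_left c hab) (fun c hab => h.idemLE_unit_mul_right c hab)
  have hYJ : Y ∈ J := by
    refine hSl Y hY ⟨fun x => ?_, fun x y => ?_⟩
    · obtain ⟨a, rfl⟩ := hπ x
      have k : h.unit (a * a) = h.unit a := h.unit_mul_self a
      have refl := IsNormalOrthogroup.IdemLE.of_le (h.unit_idem a) (h.unit_idem a) le_rfl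
      refine (map_mul π a a).symm.trans (le_antisymm (α := Y) ((hle _ _).2 ?_) ((hle _ _).2 ?_))
      · rwa [k]
      · rwa [k]
    · obtain ⟨a, rfl⟩ := hπ x
      obtain ⟨b, rfl⟩ := hπ y
      exact (map_mul π a b).symm.trans ((le_antisymm (α := Y)
        ((hle _ _).2 (h.idemLE_unit_mul_comm a b))
        ((hle _ _).2 (h.idemLE_unit_mul_comm b a))).trans (map_mul π b a))
  let I : Type := {e : S // e * e = e}
  have neB : ∀ i : I, Nonempty (h.bandClass i.1 i.2) := fun i =>
    ⟨⟨i.1, i.2, by rw [i.2, i.2], by rw [i.2, i.2]⟩⟩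
  have neG : ∀ i : I, Nonempty (IsNormalOrthogroup.groupClass i.1) := fun i =>
    ⟨⟨i.1, i.2, i.2, i.1, i.2, i.2, i.2, i.2⟩⟩
  let B : I → FinOrdSemigroup := fun i => (S.sub (h.bandClass i.1 i.2)).forget.discrete
  let C : I → FinOrdSemigroup := fun i =>
    (S.sub (IsNormalOrthogroup.groupClass i.1)).forget.discrete
  have hsub : ∀ (s : Subsemigroup S) [Nonempty s], S.sub s ∈ V := fun s _ =>
    V.sub_mem (S := S.sub s) (T := S) ⟨fun x => x.1, fun _ _ => rfl⟩ (fun _ _ => Iff.rfl) hS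
  have hB : ∀ i, B i ∈ J := fun i => hRB _ (hsub _)
    ⟨fun x => Subtype.ext x.2.1, fun x y => Subtype.ext
      (h.idem_mul_mul_eq i.2 y.2.1 x.2.2.2 y.2.2.2 y.2.2.1)⟩
  have hC : ∀ i, C i ∈ J := fun i => hG _ (hsub _)
    (IsNormalOrthogroup.isGroupSemigroup_groupClass i.2)
  refine J.mem_of_divides ?_ (J.prod_mem hYJ (J.prod_mem (J.pi_mem B hB) (J.pi_mem C hC)))
  let val : ∀ i, B i → S := fun i x => x.1
  let val' : ∀ i, C i → S := fun i x => x.1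
  -- The coordinates at `e` are prescribed only if the class of `a` lies above that of `e`, and are
  -- arbitrary otherwise. This respects products, since a class above `e` for `a b` requires the
  -- same for `a` and for `b`.
  refine ⟨fun a x => x.1 = π a ∧ ∀ i : I, i.1 * h.unit a * i.1 = i.1 →
    val i (x.2.1 i) = h.unit a * i.1 * h.unit a ∧ val' i (x.2.2 i) = i.1 * a * i.1,
    fun a => ?_, ?_, ?_⟩
  · refine ⟨(π a, fun i => if k : i.1 * h.unit a * i.1 = i.1 then
      ⟨_, h.local_mem_bandClass i.2 k⟩ else (neB i).some, fun i =>
      if k : i.1 * h.unit a * i.1 = i.1 then ⟨_, h.local_mem_groupClass i.2 k⟩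
      else (neG i).some), rfl, fun i k => ⟨?_, ?_⟩⟩
    · exact congrArg Subtype.val (dif_pos k)
    · exact congrArg Subtype.val (dif_pos k)
  · rintro a b x y ⟨hx, hx'⟩ ⟨hy, hy'⟩
    refine ⟨?_, fun i k => ?_⟩
    · rw [map_mul, ← hx, ← hy]
      rfl
    · obtain ⟨ka, kb⟩ := (h.le_unit_mul_iff i.2).1 k
      obtain ⟨p₁, p₂⟩ := hx' i ka
      obtain ⟨q₁, q₂⟩ := hy' i kb
      constructor
      · rw [h.unit_mul_mul i.2 ka kb, ← p₁, ← q₁]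
        rfl
      · rw [h.local_mul i.2 ka kb, ← p₂, ← q₂]
        rfl
  · rintro a b x y ⟨hx, hx'⟩ ⟨hy, hy'⟩ hxy
    have h₁ : x.1 ≤ y.1 := hxy.1
    rw [hx, hy, hle] at h₁
    refine h.le_of_idemLE h₁ (fun e he ka kb => ?_) (fun e he ka kb => ?_)
    · rw [← (hx' ⟨e, he⟩ ka).1, ← (hy' ⟨e, he⟩ kb).1]
      exact congrArg (val ⟨e, he⟩) (hxy.2.1 ⟨e, he⟩)
    · rw [← (hx' ⟨e, he⟩ ka).2, ← (hy' ⟨e, he⟩ kb).2]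
      exact congrArg (val' ⟨e, he⟩) (hxy.2.2 ⟨e, he⟩)

open Pseudovariety in
theorem le_sup_of_le_NOCR {V : OrdPseudovariety} (hV : V ≤ NOCR.toOrd) :
    V ≤ (V ⊓ Sl.toOrd) ⊔ ((V.disc ⊓ RB).toOrd ⊔ (V.disc ⊓ G).toOrd) := fun S hS =>
  mem_of_components (V := V) hS (hV S hS)
    (fun T hT k => (le_sup_left : V ⊓ Sl.toOrd ≤ _) T ⟨hT, k⟩)
    (fun T hT k => (le_sup_left.trans le_sup_right : (V.disc ⊓ RB).toOrd ≤ _) T.forget.discrete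
      ⟨V.discrete_mem_of_rectangularBand T hT k, k⟩)
    (fun T hT k => (le_sup_right.trans le_sup_right : (V.disc ⊓ G).toOrd ≤ _) T.forget.discrete
      ⟨V.discrete_mem_of_group T hT k, k⟩)

theorem toOrd_disc_inf_RB (V : OrdPseudovariety) :
    (V.disc ⊓ Pseudovariety.RB).toOrd = V ⊓ Pseudovariety.RB.toOrd :=
  toOrd_disc_inf V.discrete_mem_of_rectangularBand

theorem toOrd_disc_inf_G (V : OrdPseudovariety) :
    (V.disc ⊓ Pseudovariety.G).toOrd = V ⊓ Pseudovariety.G.toOrd :=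
  toOrd_disc_inf V.discrete_mem_of_group

end OrdPseudovariety

/-! ### The lattice isomorphisms -/

namespace Pseudovariety

theorem NB_le_NOCR : NB ≤ NOCR := fun _ hS =>
  ⟨fun a => ⟨a, by rw [hS.1, hS.1], rfl⟩, fun _ _ _ _ => hS.1 _, fun _ _ _ _ _ _ => hS.2 _ _ _⟩

theorem Sl_le_NB : Sl ≤ NB := fun _ hS =>
  ⟨hS.1, fun x y z => by rw [mul_assoc x y z, hS.2 y z, ← mul_assoc]⟩

theorem RB_le_NB : RB ≤ NB := fun _ hS =>
  ⟨hS.1, fun x y z => by rw [mul_assoc x y z, mul_assoc x z y, hS.2, hS.2]⟩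

theorem G_le_NOCR : G ≤ NOCR := by
  rintro S ⟨u, hu, hinv⟩
  have key : ∀ e : S, e * e = e → e = u := fun e he =>
    eq_of_idempotent_of_identity hu (hinv e) he
  refine ⟨fun a => ?_, fun e f he hf => ?_, fun e f g he hf hg => ?_⟩
  · obtain ⟨b, hb, hb'⟩ := hinv a
    exact ⟨b, by rw [hb, (hu a).1], hb.trans hb'.symm⟩
  · rw [key e he, key f hf, (hu u).1, (hu u).1]
  · rw [key e he, key f hf, key g hg]

theorem subsingleton_of_mem {S : FinSemigroup} (h : ∀ x : S, x * x = x) (hS : S ∈ G) :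
    Subsingleton S := by
  obtain ⟨u, hu, hinv⟩ := hS
  have key : ∀ e : S, e = u := fun e => eq_of_idempotent_of_identity hu (hinv e) (h e)
  exact ⟨fun a b => (key a).trans (key b).symm⟩

/-- The decomposition of a pseudovariety of ordered normal orthogroups into its semilattices,
its rectangular bands and its groups. -/
def decomposition : NOCR.Lo ≃o Sl.Lo × RB.L × G.L :=
  Equiv.toOrderIso
    { toFun := fun V => (⟨V.1 ⊓ Sl.toOrd, Set.mem_Iic.2 inf_le_right⟩, ⟨V.1.disc ⊓ RB, Set.mem_Iic.2 inf_le_right⟩,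
        ⟨V.1.disc ⊓ G, Set.mem_Iic.2 inf_le_right⟩)
      invFun := fun x => ⟨x.1.1 ⊔ (x.2.1.1.toOrd ⊔ x.2.2.1.toOrd),
        sup_le (x.1.2.trans (toOrd_mono (Sl_le_NB.trans NB_le_NOCR)))
          (sup_le (toOrd_mono (x.2.1.2.trans (RB_le_NB.trans NB_le_NOCR)))
            (toOrd_mono (x.2.2.2.trans G_le_NOCR)))⟩
      left_inv := fun V => Subtype.ext (le_antisymm
        (sup_le inf_le_left (sup_le
          ((OrdPseudovariety.toOrd_disc_inf_RB _).le.trans inf_le_left)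
          ((OrdPseudovariety.toOrd_disc_inf_G _).le.trans inf_le_left)))
        (OrdPseudovariety.le_sup_of_le_NOCR V.2))
      right_inv := fun ⟨⟨X, hX⟩, ⟨Y, hY⟩, ⟨Z, hZ⟩⟩ => by
        refine Prod.ext (Subtype.ext ?_) (Prod.ext (Subtype.ext ?_) (Subtype.ext ?_))
        · exact le_antisymm
            (fun T hT => OrdPseudovariety.mem_left_of_mem_sup_sup hX hY hZ hT.1 hT.2)
            (le_inf le_sup_left hX)
        · refine toOrd_injective ((OrdPseudovariety.toOrd_disc_inf_RB _).trans (le_antisymm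
            (fun T hT => OrdPseudovariety.mem_middle_of_mem_sup_sup hX hY hZ hT.1 hT.2)
            (le_inf (le_sup_left.trans le_sup_right) (toOrd_mono hY))))
        · refine toOrd_injective ((OrdPseudovariety.toOrd_disc_inf_G _).trans (le_antisymm
            (fun T hT => OrdPseudovariety.mem_right_of_mem_sup_sup hX hY hZ hT.1 hT.2)
            (le_inf (le_sup_right.trans le_sup_right) (toOrd_mono hZ)))) }
    (fun V W h => ⟨inf_le_inf_right Sl.toOrd (show V.1 ≤ W.1 from h), inf_le_inf_right _ (OrdPseudovariety.disc_mono h),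
      inf_le_inf_right _ (OrdPseudovariety.disc_mono h)⟩)
    (fun x y h => by
      obtain ⟨h₁, h₂, h₃⟩ := h
      change x.1.1 ⊔ (x.2.1.1.toOrd ⊔ x.2.2.1.toOrd) ≤ y.1.1 ⊔ (y.2.1.1.toOrd ⊔ y.2.2.1.toOrd)
      exact sup_le_sup h₁ (sup_le_sup (toOrd_mono h₂) (toOrd_mono h₃)))

/-- As `V` is the join of its three parts, inclusion can be tested on them. -/
theorem le_of_inf_le {V W : OrdPseudovariety} (hV : V ≤ NOCR.toOrd)
    (h₁ : V ⊓ Sl.toOrd ≤ W) (h₂ : V ⊓ RB.toOrd ≤ W) (h₃ : V ⊓ G.toOrd ≤ W) : V ≤ W := by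
  refine (OrdPseudovariety.le_sup_of_le_NOCR hV).trans ?_
  rw [OrdPseudovariety.toOrd_disc_inf_RB, OrdPseudovariety.toOrd_disc_inf_G]
  exact sup_le h₁ (sup_le h₂ h₃)

theorem inf_G_le_of_le_NB {V W : OrdPseudovariety} (hV : V ≤ NB.toOrd) : V ⊓ G.toOrd ≤ W :=
  fun T hT => W.one_mem (subsingleton_of_mem (S := T.forget) (hV T hT.1).1 hT.2)

/-- For a pseudovariety `X` of ordered normal bands and a pseudovariety `Z` of groups, the join of
`X` and `Z` is the join of the semilattices of `X`, the rectangular bands of `X` and `Z`. -/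
theorem sup_le_of_le_NB {X : OrdPseudovariety} {Z : Pseudovariety} (hX : X ≤ NB.toOrd) :
    X ⊔ Z.toOrd ≤ (X ⊓ Sl.toOrd) ⊔ ((X.disc ⊓ RB).toOrd ⊔ Z.toOrd) := by
  refine sup_le (le_of_inf_le (hX.trans (toOrd_mono NB_le_NOCR)) le_sup_left ?_
    (inf_G_le_of_le_NB hX)) (le_sup_right.trans le_sup_right)
  rw [OrdPseudovariety.toOrd_disc_inf_RB]
  exact le_sup_left.trans le_sup_right

/-- The decomposition of a pseudovariety of ordered normal orthogroups into its normal bands and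
its groups. -/
def bandGroupDecomposition : NOCR.Lo ≃o NB.Lo × G.L :=
  Equiv.toOrderIso
    { toFun := fun V => (⟨V.1 ⊓ NB.toOrd, Set.mem_Iic.2 inf_le_right⟩, ⟨V.1.disc ⊓ G, Set.mem_Iic.2 inf_le_right⟩)
      invFun := fun x => ⟨x.1.1 ⊔ x.2.1.toOrd,
        sup_le (x.1.2.trans (toOrd_mono NB_le_NOCR)) (toOrd_mono (x.2.2.trans G_le_NOCR))⟩
      left_inv := fun V => Subtype.ext (le_antisymm
        (sup_le inf_le_left ((OrdPseudovariety.toOrd_disc_inf_G _).le.trans inf_le_left))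
        (le_of_inf_le V.2
          ((inf_le_inf_left _ (toOrd_mono Sl_le_NB)).trans le_sup_left)
          ((inf_le_inf_left _ (toOrd_mono RB_le_NB)).trans le_sup_left)
          ((OrdPseudovariety.toOrd_disc_inf_G _).ge.trans le_sup_right)))
      right_inv := fun ⟨⟨X, hX⟩, ⟨Z, hZ⟩⟩ => by
        -- Splitting `X` into its semilattices and rectangular bands makes the independence lemmas
        -- for triple joins applicable.
        have hle := sup_le_of_le_NB (Z := Z) hX
        refine Prod.ext (Subtype.ext ?_) (Subtype.ext ?_)
        · refine le_antisymm (le_of_inf_le (inf_le_right.trans (toOrd_mono NB_le_NOCR)) ?_ ?_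
            (inf_G_le_of_le_NB inf_le_right)) (le_inf le_sup_left hX)
          · exact fun T hT => (OrdPseudovariety.mem_left_of_mem_sup_sup inf_le_right inf_le_right
              hZ (hle T hT.1.1) hT.2).1
          · exact fun T hT => X.mem_of_forget_mem_disc
              (OrdPseudovariety.mem_middle_of_mem_sup_sup inf_le_right inf_le_right
                hZ (hle T hT.1.1) hT.2).1
        · exact toOrd_injective ((OrdPseudovariety.toOrd_disc_inf_G _).trans (le_antisymm
            (fun T hT => OrdPseudovariety.mem_right_of_mem_sup_sup inf_le_right inf_le_right
              hZ (hle T hT.1) hT.2)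
            (le_inf le_sup_right (toOrd_mono hZ)))) }
    (fun V W h => ⟨inf_le_inf_right NB.toOrd (show V.1 ≤ W.1 from h), inf_le_inf_right _ (OrdPseudovariety.disc_mono h)⟩)
    (fun x y h => by
      obtain ⟨h₁, h₂⟩ := h
      change x.1.1 ⊔ x.2.1.toOrd ≤ y.1.1 ⊔ y.2.1.toOrd
      exact sup_le_sup h₁ (toOrd_mono h₂))

end Pseudovariety

theorem theorem2 :
    (∃ Φ : LatticeHom Pseudovariety.NOCR.Lo
          (Pseudovariety.Sl.Lo × Pseudovariety.RB.L × Pseudovariety.G.L),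
        Function.Bijective Φ ∧
        ∀ V : Pseudovariety.NOCR.Lo,
          ((Φ V).1 : OrdPseudovariety) = (V : OrdPseudovariety) ⊓ Pseudovariety.Sl.toOrd ∧
          ((Φ V).2.1 : Pseudovariety).toOrd =
            (V : OrdPseudovariety) ⊓ Pseudovariety.RB.toOrd ∧
          ((Φ V).2.2 : Pseudovariety).toOrd =
            (V : OrdPseudovariety) ⊓ Pseudovariety.G.toOrd) ∧
    ∃ Ψ : LatticeHom Pseudovariety.NOCR.Lo (Pseudovariety.NB.Lo × Pseudovariety.G.L),
      Function.Bijective Ψ := by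
  refine ⟨⟨(Pseudovariety.decomposition : LatticeHom _ _), Pseudovariety.decomposition.bijective,
    fun V => ⟨rfl, ?_, ?_⟩⟩, (Pseudovariety.bandGroupDecomposition : LatticeHom _ _),
    Pseudovariety.bandGroupDecomposition.bijective⟩
  · exact OrdPseudovariety.toOrd_disc_inf_RB V.1
  · exact OrdPseudovariety.toOrd_disc_inf_G V.1
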